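/- Let $n\ge 2$, let $\Omega\subset\mathbb{R}^n$ be a bounded domain (nonempty, open, connected), and let $0<s\le t<1<p\le q<\infty$ and $\Lambda>1$. Let $K_{sp},K_{tq}:\mathbb{R}^n\times\mathbb{R}^n\to\mathbb{R}$ be measurable and symmetric ($K(x,y)=K(y,x)$ for all $x,y$) with $$\frac{\Lambda^{-1}}{|x-y|^{n+sp}}\le K_{sp}(x,y)\le\frac{\Lambda}{|x-y|^{n+sp}},\qquad \frac{\Lambda^{-1}}{|x-y|^{n+tq}}\le K_{tq}(x,y)\le\frac{\Lambda}{|x-y|^{n+tq}}$$ for a.e. $(x,y)\in\mathbb{R}^n\times\mathbb{R}^n$, and let $a:\mathbb{R}^n\times\mathbb{R}^n\to\mathbb{R}$ be measurable, symmetric, nonnegative and (essentially) bounded. Put $\mathcal{C}_\Omega=(\mathbb{R}^n\times\mathbb{R}^n)\setminus((\mathbb{R}^n\setminus\Omega)\times(\mathbb{R}^n\setminus\Omega))$ and $$H(x,y,\tau)=\frac{\tau^p}{|x-y|^{sp}}+a(x,y)\frac{\tau^q}{|x-y|^{tq}}\qquad(\tau\ge 0).$$ Let $\mathcal{A}(\Omega)$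 be the set of measurable $v:\mathbb{R}^n\to\mathbb{R}$ with $v|_\Omega\in L^p(\Omega)$ and $\iint_{\mathcal{C}_\Omega}H(x,y,|v(x)-v(y)|)\,\frac{dx\,dy}{|x-y|^n}<\infty$, and let $L^{q-1}_{sp}(\mathbb{R}^n)$ be the set of measurable $v:\mathbb{R}^n\to\mathbb{R}$ with $\int_{\mathbb{R}^n}\frac{|v(x)|^{q-1}}{(1+|x|)^{n+sp}}\,dx<\infty$. A function $u\in\mathcal{A}(\Omega)$ is called a weak solution (of the nonlocal double phase equation with data $K_{sp},K_{tq},a$ in $\Omega$) if $$\iint_{\mathcal{C}_\Omega}\Big[|u(x)-u(y)|^{p-2}(u(x)-u(y))(\varphi(x)-\varphi(y))K_{sp}(x,y)+a(x,y)|u(x)-u(y)|^{q-2}(u(x)-u(y))(\varphi(x)-\varphi(y))K_{tq}(x,y)\Big]\,dx\,dy=0$$ for every $\varphi\in\mathcal{A}(\Omega)$ with $\varphi=0$ a.e. in $\mathbb{R}^n\setminus\Omega$. Theorem 1.1. Assume that $p\le q\le\frac{np}{n-sp}$ if $sp<n$, and $p\le q<\infty$ if $sp\ge n$. Then every weak solution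 $u\in\mathcal{A}(\Omega)\cap L^{q-1}_{sp}(\mathbb{R}^n)$ is locally bounded in $\Omega$, i.e. $u\in L^\infty_{\mathrm{loc}}(\Omega)$: for every compact $S\subset\Omega$ there is $M<\infty$ with $|u|\le M$ a.e. in $S$. -/

import Mathlib

open MeasureTheory

noncomputable section

namespace DoublePhase

/-- `f` is symmetric: `f(x,y) = f(y,x)` for all `x, y`. -/
def IsSymm {n : ℕ} (f : EuclideanSpace ℝ (Fin n) → EuclideanSpace ℝ (Fin n) → ℝ) : Prop :=
  ∀ x y, f x y = f y x

/-- `K` is a (Lebesgue) measurable symmetric kernel of order `(σ, r)` with ellipticity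
constant `Λ`: `Λ⁻¹ |x-y|^{-(n+σr)} ≤ K(x,y) ≤ Λ |x-y|^{-(n+σr)}` for a.e. `(x,y)`. -/
structure IsKernel {n : ℕ} (σ r Λ : ℝ)
    (K : EuclideanSpace ℝ (Fin n) → EuclideanSpace ℝ (Fin n) → ℝ) : Prop where
  measurable : AEMeasurable (fun z : EuclideanSpace ℝ (Fin n) × EuclideanSpace ℝ (Fin n) =>
    K z.1 z.2) volume
  symm : IsSymm K
  lower : ∀ᵐ z : EuclideanSpace ℝ (Fin n) × EuclideanSpace ℝ (Fin n),
    Λ⁻¹ / ‖z.1 - z.2‖ ^ ((n : ℝ) + σ * r) ≤ K z.1 z.2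
  upper : ∀ᵐ z : EuclideanSpace ℝ (Fin n) × EuclideanSpace ℝ (Fin n),
    K z.1 z.2 ≤ Λ / ‖z.1 - z.2‖ ^ ((n : ℝ) + σ * r)

/-- `a` is a nonnegative, (Lebesgue) measurable, symmetric and bounded coefficient. -/
structure IsCoefficient {n : ℕ}
    (a : EuclideanSpace ℝ (Fin n) → EuclideanSpace ℝ (Fin n) → ℝ) : Prop where
  measurable : AEMeasurable (fun z : EuclideanSpace ℝ (Fin n) × EuclideanSpace ℝ (Fin n) =>
    a z.1 z.2) volume
  symm : IsSymm a
  nonneg : ∀ x y, 0 ≤ a x y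
  bounded : ∃ M : ℝ, ∀ᵐ z : EuclideanSpace ℝ (Fin n) × EuclideanSpace ℝ (Fin n),
    a z.1 z.2 ≤ M

/-- The set `C_Ω = (ℝⁿ × ℝⁿ) \ ((ℝⁿ \ Ω) × (ℝⁿ \ Ω))`. -/
def crossSet {n : ℕ} (Ω : Set (EuclideanSpace ℝ (Fin n))) :
    Set (EuclideanSpace ℝ (Fin n) × EuclideanSpace ℝ (Fin n)) :=
  (Ωᶜ ×ˢ Ωᶜ)ᶜ

/-- The double phase integrand `H(x,y,τ) = τ^p / |x-y|^{sp} + a(x,y) τ^q / |x-y|^{tq}`. -/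
def H {n : ℕ} (s t p q : ℝ) (a : EuclideanSpace ℝ (Fin n) → EuclideanSpace ℝ (Fin n) → ℝ)
    (x y : EuclideanSpace ℝ (Fin n)) (τ : ℝ) : ℝ :=
  τ ^ p / ‖x - y‖ ^ (s * p) + a x y * (τ ^ q / ‖x - y‖ ^ (t * q))

/-- The function space `𝒜(Ω)`: measurable `v : ℝⁿ → ℝ` with `v|_Ω ∈ L^p(Ω)` and
`∬_{C_Ω} H(x,y,|v(x)-v(y)|) |x-y|^{-n} dx dy < ∞`. -/
structure MemA {n : ℕ} (s t p q : ℝ)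
    (a : EuclideanSpace ℝ (Fin n) → EuclideanSpace ℝ (Fin n) → ℝ)
    (Ω : Set (EuclideanSpace ℝ (Fin n))) (v : EuclideanSpace ℝ (Fin n) → ℝ) : Prop where
  measurable : AEMeasurable v volume
  memLp : MemLp v (ENNReal.ofReal p) (volume.restrict Ω)
  energy_lt_top : ∫⁻ z in crossSet Ω,
    ENNReal.ofReal (H s t p q a z.1 z.2 |v z.1 - v z.2| / ‖z.1 - z.2‖ ^ n) < ⊤

/-- The tail space `L^{q-1}_{sp}(ℝⁿ)`: measurable `v : ℝⁿ → ℝ` with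
`∫ |v(x)|^{q-1} / (1+|x|)^{n+sp} dx < ∞`. -/
structure MemTail {n : ℕ} (s p q : ℝ) (v : EuclideanSpace ℝ (Fin n) → ℝ) : Prop where
  measurable : AEMeasurable v volume
  lt_top : ∫⁻ x, ENNReal.ofReal (|v x| ^ (q - 1) / (1 + ‖x‖) ^ ((n : ℝ) + s * p)) < ⊤

/-- The integrand of the weak formulation,
`|u(x)-u(y)|^{p-2}(u(x)-u(y))(φ(x)-φ(y)) K_sp(x,y)
  + a(x,y)|u(x)-u(y)|^{q-2}(u(x)-u(y))(φ(x)-φ(y)) K_tq(x,y)`.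
(At `u(x) = u(y)` both terms vanish, also for exponents below `2`.) -/
def weakIntegrand {n : ℕ} (p q : ℝ)
    (Ksp Ktq a : EuclideanSpace ℝ (Fin n) → EuclideanSpace ℝ (Fin n) → ℝ)
    (u φ : EuclideanSpace ℝ (Fin n) → ℝ) (x y : EuclideanSpace ℝ (Fin n)) : ℝ :=
  |u x - u y| ^ (p - 2) * (u x - u y) * (φ x - φ y) * Ksp x y
    + a x y * (|u x - u y| ^ (q - 2) * (u x - u y) * (φ x - φ y) * Ktq x y)

/-- `u ∈ 𝒜(Ω)` is a weak solution of the nonlocal double phase equation in `Ω`: the weak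
formulation holds for every `φ ∈ 𝒜(Ω)` with `φ = 0` a.e. in `ℝⁿ \ Ω`. For kernels and
coefficients as above the integrand is absolutely integrable over `C_Ω` by the finite energy
of `u` and `φ` and Hölder's inequality. -/
structure IsWeakSolution {n : ℕ} (s t p q : ℝ)
    (Ksp Ktq a : EuclideanSpace ℝ (Fin n) → EuclideanSpace ℝ (Fin n) → ℝ)
    (Ω : Set (EuclideanSpace ℝ (Fin n))) (u : EuclideanSpace ℝ (Fin n) → ℝ) : Prop where
  memA : MemA s t p q a Ω u
  weak_eq : ∀ φ : EuclideanSpace ℝ (Fin n) → ℝ, MemA s t p q a Ω φ →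
    (∀ᵐ x, x ∉ Ω → φ x = 0) →
    ∫ z in crossSet Ω, weakIntegrand p q Ksp Ktq a u φ z.1 z.2 = 0

/-- `u` is locally bounded in `Ω`, that is `u ∈ L^∞_loc(Ω)`: on every compact subset of `Ω`
it is bounded almost everywhere. -/
def LocallyBoundedIn {n : ℕ} (Ω : Set (EuclideanSpace ℝ (Fin n)))
    (u : EuclideanSpace ℝ (Fin n) → ℝ) : Prop :=
  ∀ S : Set (EuclideanSpace ℝ (Fin n)), IsCompact S → S ⊆ Ω →
    ∃ M : ℝ, ∀ᵐ x, x ∈ S → |u x| ≤ M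

end DoublePhase

end

/-!
# Local boundedness of solutions of nonlocal double phase equations

The proof is a De Giorgi iteration over the truncations `w = (u - k)₊` on the sublevel sets
`{d < ρ}` of the distance `d` to the given compact set; applied to `u` and to `-u` it gives the
two-sided bound.

Testing the equation with `w η^q`, where `η` is a cutoff, bounds the Gagliardo energy of `w` of order
`(s, p)` on a sublevel set by `h^{-N} ∫ (w^p + w^q + w)` over a sublevel set larger by the gap `h`
(`caccioppoli`). The pointwise inequalities behind it hold for each phase separately
(`indicator_le_phase_add_error`), and the positive contribution of the `q`-phase is discarded.
Interactions with distant points produce the tail integral of `u`, which is finite by hypothesis.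
The Sobolev inequality (`fractional_sobolev`, and `local_fractional_sobolev` with a cutoff) bounds
`∫ w^κ` by the power `κ / p` of that energy, for an exponent `κ > p` with `κ ≥ q`. The hypothesis
on `q` enters only here: for `s p < n` the critical exponent `κ = n p / (n - s p)` is admissible.

Since every power of `w` up to the exponent `κ` is controlled by `w^κ` at a slightly lower level
(`truncation_rpow_le`), both estimates combine into `Y_{j+1} ≤ (A b^j Y_j)^{κ/p}` for
`Y_j = ∫_{d < r_j} (u - k_j)₊^κ` along decreasing radii `r_j` and increasing levels
`k_j = K (2 - 2^{-j})` (`truncation_energy_step`), with constants that do not depend on `K ≥ 1`.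
As `κ / p > 1`, `Y_j` tends to `0` if `Y_0` is small (`exists_tendsto_zero_of_le_rpow`), and `Y_0`
is small for large `K` by dominated convergence: the Sobolev inequality for `|u|` shows that
`u ∈ L^κ` near the compact set. This choice of `K` by smallness, rather than by a quantitative
gain in measure, is what admits the critical case `q = n p / (n - s p)`.
-/

noncomputable section

namespace DoublePhase

open Set Metric Filter Topology
open scoped ENNReal

variable {n : ℕ}

local notation "𝔼" => EuclideanSpace ℝ (Fin n)

/-! ### The fractional Sobolev inequality -/

lemma lintegral_ball_norm_rpow_lt_top (hn : 0 < n) {γ : ℝ} (hγ : 0 < γ) (D : ℝ) :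
    ∫⁻ z in ball (0 : 𝔼) D, ENNReal.ofReal (‖z‖ ^ (γ - n)) < ⊤ := by
  have : Nonempty (Fin n) := ⟨⟨0, hn⟩⟩
  have h : IntegrableOn (fun z : 𝔼 => (fun y : ℝ => y ^ (γ - n)) ‖z‖) (ball 0 D) volume := by
    refine (integrableOn_fun_norm_addHaar volume (f := fun y : ℝ => y ^ (γ - n))).2 ?_
    have h1 : IntegrableOn (fun y : ℝ => y ^ (γ - 1)) (Ioo 0 D) := by
      rcases le_or_gt D 0 with hD | hD
      · simp [Ioo_eq_empty_of_le hD]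
      · have := (intervalIntegral.intervalIntegrable_rpow' (a := 0) (b := D)
          (r := γ - 1) (by linarith))
        rw [intervalIntegrable_iff_integrableOn_Ioo_of_le hD.le] at this
        exact this
    refine h1.congr_fun (fun y hy => ?_) measurableSet_Ioo
    have hy0 : 0 < y := hy.1
    rw [smul_eq_mul, finrank_euclideanSpace_fin, ← Real.rpow_natCast, ← Real.rpow_add hy0,
      Nat.cast_sub hn]
    push_cast
    ring_nf
  have h2 := h.lintegral_lt_top
  exact h2

/-- The pointwise form of the fractional Sobolev inequality. By Chebyshev's inequality `f` is at
most `f x / 2` on half of the ball about `x` whose volume is comparable to `∫ f^κ / f(x)^κ`; there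
`|f x - f y| ≥ f x / 2`. -/
lemma rpow_le_mul_lintegral_gagliardo (hn : 0 < n) {p κ : ℝ} (hp : 0 < p) (hpκ : p < κ) :
    ∃ C : ℝ≥0∞, C ≠ ⊤ ∧ ∀ f : 𝔼 → ℝ, (∀ x, 0 ≤ f x) → AEMeasurable f volume →
      ∫⁻ x, ENNReal.ofReal (f x ^ κ) ≠ ⊤ → ∫⁻ x, ENNReal.ofReal (f x ^ κ) ≠ 0 →
      ∀ x, ENNReal.ofReal (f x ^ κ) ≤ C * (∫⁻ x, ENNReal.ofReal (f x ^ κ)) ^ (1 - p / κ) *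
        ∫⁻ y, ENNReal.ofReal (|f x - f y| ^ p / ‖x - y‖ ^ (n + n * (1 - p / κ))) := by
  have : Nonempty (Fin n) := ⟨⟨0, hn⟩⟩
  have hκ : 0 < κ := hp.trans hpκ
  have hn' : (0 : ℝ) < n := by exact_mod_cast hn
  set ω : ℝ := (volume (ball (0 : 𝔼) 1)).toReal with hω
  have hω0 : 0 < ω := ENNReal.toReal_pos (measure_ball_pos _ _ one_pos).ne' measure_ball_lt_top.ne
  have hωe : volume (ball (0 : 𝔼) 1) = ENNReal.ofReal ω :=
    (ENNReal.ofReal_toReal measure_ball_lt_top.ne).symm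
  set C : ℝ := 2 ^ p * (2 / ω) ^ (2 - p / κ) * ((2 : ℝ) ^ κ) ^ (1 - p / κ) with hC
  refine ⟨ENNReal.ofReal C, ENNReal.ofReal_ne_top, fun f hf0 hfm hI hI0 x => ?_⟩
  rcases (hf0 x).eq_or_lt with hx | hx
  · simp [← hx, Real.zero_rpow hκ.ne']
  set I := ∫⁻ x, ENNReal.ofReal (f x ^ κ) with hIdef
  set J := I.toReal with hJ
  have hJ0 : 0 < J := ENNReal.toReal_pos hI0 hI
  have hIJ : I = ENNReal.ofReal J := (ENNReal.ofReal_toReal hI).symm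
  set t := f x with ht
  set m : ℝ := 2 ^ κ * J / t ^ κ with hm
  have hm0 : 0 < m := by positivity
  set r : ℝ := (2 * m / ω) ^ (1 / (n : ℝ)) with hr
  have hr0 : 0 < r := by positivity
  have hrn : r ^ n = 2 * m / ω := by
    rw [hr, ← Real.rpow_natCast, ← Real.rpow_mul (by positivity),
      one_div_mul_cancel hn'.ne', Real.rpow_one]
  have hball : volume (ball x r) = ENNReal.ofReal (2 * m) := by
    rw [Measure.addHaar_ball _ _ hr0.le, finrank_euclideanSpace_fin, hrn, hωe,
      ← ENNReal.ofReal_mul (by positivity)]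
    congr 1
    field_simp
  set A : Set 𝔼 := {y | ENNReal.ofReal ((t / 2) ^ κ) ≤ ENNReal.ofReal (f y ^ κ)} with hA
  have hAvol : volume A ≤ ENNReal.ofReal m := by
    have h1 : ENNReal.ofReal ((t / 2) ^ κ) * volume A ≤ I :=
      mul_meas_ge_le_lintegral₀ (by fun_prop) _
    have h2 : volume A ≤ I / ENNReal.ofReal ((t / 2) ^ κ) := by
      rw [ENNReal.le_div_iff_mul_le (Or.inl (by simp; positivity)) (Or.inl ENNReal.ofReal_ne_top),
        mul_comm]
      exact h1
    refine h2.trans (le_of_eq ?_)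
    rw [hIJ, ← ENNReal.ofReal_div_of_pos (by positivity)]
    congr 1
    rw [hm, Real.div_rpow hx.le (by norm_num)]
    field_simp
  have hdiff : ENNReal.ofReal m ≤ volume (ball x r \ A) := by
    refine le_trans ?_ (le_measure_sdiff)
    rw [hball]
    calc ENNReal.ofReal m = ENNReal.ofReal (2 * m) - ENNReal.ofReal m := by
          rw [← ENNReal.ofReal_sub _ hm0.le]; congr 1; ring
      _ ≤ _ := tsub_le_tsub_left hAvol _
  set g : 𝔼 → ℝ≥0∞ := fun y =>
    ENNReal.ofReal (|t - f y| ^ p / ‖x - y‖ ^ (n + n * (1 - p / κ))) with hg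
  have hgm : AEMeasurable g volume := by fun_prop
  set e : ℝ := n + n * (1 - p / κ) with he
  have he0 : 0 ≤ e := by
    have : p / κ < 1 := (div_lt_one hκ).2 hpκ
    have : 0 ≤ n * (1 - p / κ) := mul_nonneg hn'.le (by linarith)
    linarith
  have hD : ENNReal.ofReal ((t / 2) ^ p / r ^ e * m) ≤ ∫⁻ y, g y := by
    have h1 : ENNReal.ofReal ((t / 2) ^ p / r ^ e) * volume (ball x r \ A) ≤ ∫⁻ y, g y := by
      refine le_trans ?_
        (mul_meas_ge_le_lintegral₀ hgm (ENNReal.ofReal ((t / 2) ^ p / r ^ e)))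
      gcongr
      rintro y ⟨hy, hyA⟩
      have hyA' : f y ^ κ < (t / 2) ^ κ := by
        simpa [hA, ENNReal.ofReal_lt_ofReal_iff (show (0 : ℝ) < (t / 2) ^ κ by positivity)]
          using hyA
      have hfy : f y < t / 2 := by
        by_contra! hcon
        exact absurd hyA' (not_lt.2 (Real.rpow_le_rpow (by positivity) hcon hκ.le))
      have hxy : 0 < ‖x - y‖ := by
        rw [norm_pos_iff, sub_ne_zero]
        rintro rfl
        linarith
      have hxyr : ‖x - y‖ ≤ r := by
        rw [mem_ball, dist_comm, dist_eq_norm] at hy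
        exact hy.le
      refine ENNReal.ofReal_le_ofReal ?_
      refine div_le_div₀ (by positivity) ?_ (by positivity)
        (Real.rpow_le_rpow hxy.le hxyr he0)
      refine Real.rpow_le_rpow (by positivity) ?_ hp.le
      rw [abs_of_pos (by linarith)]
      linarith
    refine le_trans ?_ h1
    rw [ENNReal.ofReal_mul (by positivity)]
    gcongr
  calc ENNReal.ofReal (t ^ κ)
      = ENNReal.ofReal C * ENNReal.ofReal (J ^ (1 - p / κ)) *
          ENNReal.ofReal ((t / 2) ^ p / r ^ e * m) := by
        rw [← ENNReal.ofReal_mul (by positivity), ← ENNReal.ofReal_mul (by positivity)]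
        congr 1
        refine Real.log_injOn_pos (mem_Ioi.2 (by positivity)) (mem_Ioi.2 (by positivity)) ?_
        have hlogr : Real.log r = 1 / n * (Real.log 2 + Real.log m - Real.log ω) := by
          rw [hr, Real.log_rpow (by positivity), Real.log_div (by positivity) (by positivity),
            Real.log_mul (by positivity) (by positivity)]
        have hlogm : Real.log m = κ * Real.log 2 + Real.log J - κ * Real.log t := by
          rw [hm, Real.log_div (by positivity) (by positivity),
            Real.log_mul (by positivity) (by positivity), Real.log_rpow (by positivity),
            Real.log_rpow (by positivity)]
        have hlogC : Real.log C = p * Real.log 2 + (2 - p / κ) * (Real.log 2 - Real.log ω) +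
            (1 - p / κ) * (κ * Real.log 2) := by
          rw [hC, Real.log_mul (by positivity) (by positivity),
            Real.log_mul (by positivity) (by positivity), Real.log_rpow (by positivity),
            Real.log_rpow (by positivity), Real.log_rpow (by positivity),
            Real.log_rpow (by positivity), Real.log_div (by positivity) (by positivity)]
        have hlogD : Real.log ((t / 2) ^ p / r ^ e * m) =
            p * (Real.log t - Real.log 2) - e * Real.log r + Real.log m := by
          rw [Real.log_mul (by positivity) (by positivity),
            Real.log_div (by positivity) (by positivity), Real.log_rpow (by positivity),
            Real.log_rpow (by positivity), Real.log_div (by positivity) (by positivity)]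
        rw [Real.log_mul (by positivity) (by positivity),
          Real.log_mul (by positivity) (by positivity), Real.log_rpow (by positivity),
          Real.log_rpow (by positivity), hlogC, hlogD, hlogr, hlogm, he]
        field_simp
        ring
    _ ≤ _ := by
        rw [hIJ, ENNReal.ofReal_rpow_of_pos hJ0]
        gcongr

lemma lintegral_rpow_le_of_ne_top (hn : 0 < n) {p κ : ℝ} (hp : 0 < p) (hpκ : p < κ) :
    ∃ C : ℝ≥0∞, C ≠ ⊤ ∧ ∀ f : 𝔼 → ℝ, (∀ x, 0 ≤ f x) → AEMeasurable f volume →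
      ∫⁻ x, ENNReal.ofReal (f x ^ κ) ≠ ⊤ →
      ∫⁻ x, ENNReal.ofReal (f x ^ κ) ≤ (C * ∫⁻ z : 𝔼 × 𝔼,
        ENNReal.ofReal (|f z.1 - f z.2| ^ p / ‖z.1 - z.2‖ ^ (n + n * (1 - p / κ)))) ^ (κ / p) := by
  obtain ⟨C, hC, h⟩ := rpow_le_mul_lintegral_gagliardo (n := n) hn hp hpκ
  have hκ : 0 < κ := hp.trans hpκ
  refine ⟨C, hC, fun f hf0 hfm hI => ?_⟩
  rcases eq_or_ne (∫⁻ x, ENNReal.ofReal (f x ^ κ)) 0 with hI0 | hI0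
  · rw [hI0]; exact zero_le
  have h1 := h f hf0 hfm hI hI0
  set I := ∫⁻ x, ENNReal.ofReal (f x ^ κ) with hIdef
  set S := ∫⁻ z : 𝔼 × 𝔼,
    ENNReal.ofReal (|f z.1 - f z.2| ^ p / ‖z.1 - z.2‖ ^ (n + n * (1 - p / κ))) with hS
  have hIne : I ^ (1 - p / κ) ≠ ⊤ := by
    refine ENNReal.rpow_ne_top_of_nonneg ?_ hI
    have : p / κ < 1 := (div_lt_one hκ).2 hpκ
    linarith
  have hI1 : I ≤ C * I ^ (1 - p / κ) * S := by
    calc I ≤ ∫⁻ x, C * I ^ (1 - p / κ) * ∫⁻ y,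
          ENNReal.ofReal (|f x - f y| ^ p / ‖x - y‖ ^ (n + n * (1 - p / κ))) :=
          lintegral_mono h1
      _ = C * I ^ (1 - p / κ) * S := by
          rw [lintegral_const_mul' _ _ (ENNReal.mul_ne_top hC hIne), hS, Measure.volume_eq_prod,
            lintegral_prod]
          have h1 := hfm.comp_fst (ν := (volume : Measure 𝔼))
          have h2 := hfm.comp_snd (μ := (volume : Measure 𝔼))
          fun_prop
  have hI2 : I ^ (p / κ) ≤ C * S := by
    have hpos : I ^ (1 - p / κ) ≠ 0 := by
      simp [ENNReal.rpow_eq_zero_iff, hI0, hI]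
    have : I ^ (1 - p / κ) * I ^ (p / κ) ≤ I ^ (1 - p / κ) * (C * S) := by
      rw [← ENNReal.rpow_add _ _ hI0 hI, sub_add_cancel, ENNReal.rpow_one]
      refine hI1.trans (le_of_eq (by ring))
    exact (ENNReal.mul_le_mul_iff_right hpos hIne).1 this
  calc I = (I ^ (p / κ)) ^ (κ / p) := by
        rw [← ENNReal.rpow_mul, show p / κ * (κ / p) = 1 by field_simp, ENNReal.rpow_one]
    _ ≤ _ := by gcongr

/-- The fractional Sobolev inequality for functions that vanish off a set of finite measure:
`‖f‖_κ ≤ C [f]_{σ,p}` with `σ p = n (1 - p / κ)`, that is `κ = n p / (n - σ p)`. -/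
lemma fractional_sobolev (hn : 0 < n) {p κ : ℝ} (hp : 0 < p) (hpκ : p < κ) :
    ∃ C : ℝ≥0∞, C ≠ ⊤ ∧ ∀ f : 𝔼 → ℝ, (∀ x, 0 ≤ f x) → AEMeasurable f volume →
      (∃ V : Set 𝔼, volume V ≠ ⊤ ∧ ∀ x ∉ V, f x = 0) →
      ∫⁻ x, ENNReal.ofReal (f x ^ κ) ≤ (C * ∫⁻ z : 𝔼 × 𝔼,
        ENNReal.ofReal (|f z.1 - f z.2| ^ p / ‖z.1 - z.2‖ ^ (n + n * (1 - p / κ)))) ^ (κ / p) := by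
  obtain ⟨C, hC, h⟩ := lintegral_rpow_le_of_ne_top (n := n) hn hp hpκ
  have hκ : 0 < κ := hp.trans hpκ
  refine ⟨C, hC, fun f hf0 hfm ⟨V, hV, hfV⟩ => ?_⟩
  -- truncate at height `M`: the right-hand side decreases, the left-hand side becomes finite
  have key : ∀ M : ℕ, ∫⁻ x, ENNReal.ofReal (min (f x) M ^ κ) ≤ (C * ∫⁻ z : 𝔼 × 𝔼,
      ENNReal.ofReal (|f z.1 - f z.2| ^ p / ‖z.1 - z.2‖ ^ (n + n * (1 - p / κ)))) ^ (κ / p) := by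
    intro M
    refine (h (fun x => min (f x) M) (fun x => le_min (hf0 x) (Nat.cast_nonneg _))
      (by fun_prop) ?_).trans ?_
    · refine ne_top_of_le_ne_top (b := ENNReal.ofReal ((M : ℝ) ^ κ) * volume V)
        (ENNReal.mul_ne_top ENNReal.ofReal_ne_top hV) ?_
      rw [← measure_toMeasurable V, ← setLIntegral_const, ← lintegral_indicator
        (measurableSet_toMeasurable _ _)]
      refine lintegral_mono fun x => ?_
      by_cases hx : x ∈ toMeasurable volume V
      · rw [indicator_of_mem hx]
        exact ENNReal.ofReal_le_ofReal (Real.rpow_le_rpow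
          (le_min (hf0 x) (Nat.cast_nonneg _)) (min_le_right _ _) hκ.le)
      · have : f x = 0 := hfV x fun hxV => hx (subset_toMeasurable _ _ hxV)
        simp [this, Real.zero_rpow hκ.ne']
    · have htr : ∀ z : 𝔼 × 𝔼, |min (f z.1) M - min (f z.2) M| ≤ |f z.1 - f z.2| := fun z => by
        simpa using abs_min_sub_min_le_max (f z.1) M (f z.2) M
      gcongr (C * ?_) ^ _
      exact lintegral_mono fun z => ENNReal.ofReal_le_ofReal (div_le_div_of_nonneg_right
        (Real.rpow_le_rpow (abs_nonneg _) (htr z) hp.le) (by positivity))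
  have hmono : ∀ᵐ x : 𝔼, Monotone fun M : ℕ => ENNReal.ofReal (min (f x) M ^ κ) := by
    refine ae_of_all _ fun x M M' hM => ?_
    refine ENNReal.ofReal_le_ofReal (Real.rpow_le_rpow
          (le_min (hf0 x) (Nat.cast_nonneg _)) ?_ hκ.le)
    gcongr
  have hlim : ∀ᵐ x : 𝔼, Tendsto (fun M : ℕ => ENNReal.ofReal (min (f x) M ^ κ)) atTop
      (𝓝 (ENNReal.ofReal (f x ^ κ))) := by
    refine ae_of_all _ fun x => tendsto_const_nhds.congr' ?_
    filter_upwards [eventually_ge_atTop ⌈f x⌉₊] with M hM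
    rw [min_eq_left ((Nat.le_ceil _).trans (by exact_mod_cast hM))]
  exact le_of_tendsto' (lintegral_tendsto_of_tendsto_of_monotone
    (fun M => by fun_prop) hmono hlim) key

/-! ### Cutting off in Gagliardo seminorms -/

/-- The majorant of the interactions inside `V` after a cutoff has been differentiated:
`(w(x)^r + w(y)^r) |x - y|^{γ - n}`, cut off to `x, y ∈ V` and `|x - y| < 2 M`. -/
def nearError (V : Set 𝔼) (M r γ : ℝ) (w : 𝔼 → ℝ) (z : 𝔼 × 𝔼) : ℝ :=
  (V.indicator (fun x => w x ^ r) z.1 + V.indicator (fun x => w x ^ r) z.2) *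
    (ball (0 : 𝔼) (2 * M)).indicator (fun y => ‖y‖ ^ (γ - n)) (z.1 - z.2)

/-- The majorant of the interactions of `V` with distant points:
`f(x) g(y) + f(y) g(x)` with `f` cut off to `V`. -/
def farError (V : Set 𝔼) (f g : 𝔼 → ℝ) (z : 𝔼 × 𝔼) : ℝ :=
  V.indicator f z.1 * g z.2 + V.indicator f z.2 * g z.1

lemma nearError_nonneg (V : Set 𝔼) (M r γ : ℝ) {w : 𝔼 → ℝ} (hw : ∀ x, 0 ≤ w x) (z : 𝔼 × 𝔼) :
    0 ≤ nearError V M r γ w z := by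
  have h : ∀ x, 0 ≤ V.indicator (fun x => w x ^ r) x := fun x =>
    indicator_nonneg (fun x _ => Real.rpow_nonneg (hw x) _) x
  exact mul_nonneg (add_nonneg (h _) (h _)) (indicator_nonneg (fun x _ => by positivity) _)

lemma farError_nonneg (V : Set 𝔼) {f g : 𝔼 → ℝ} (hf : ∀ x, 0 ≤ f x) (hg : ∀ x, 0 ≤ g x)
    (z : 𝔼 × 𝔼) : 0 ≤ farError V f g z := by
  have h : ∀ x, 0 ≤ V.indicator f x := fun x => indicator_nonneg (fun x _ => hf x) x
  exact add_nonneg (mul_nonneg (h _) (hg _)) (mul_nonneg (h _) (hg _))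

lemma aemeasurable_nearError {V : Set 𝔼} (hV : MeasurableSet V) (M r γ : ℝ) {w : 𝔼 → ℝ}
    (hw : AEMeasurable w volume) : AEMeasurable (nearError V M r γ w) volume := by
  have h0 : AEMeasurable (V.indicator fun x => w x ^ r) volume :=
    (hw.pow_const r).indicator hV
  have h1 : AEMeasurable (fun z : 𝔼 × 𝔼 => V.indicator (fun x => w x ^ r) z.1) volume :=
    h0.comp_fst
  have h2 : AEMeasurable (fun z : 𝔼 × 𝔼 => V.indicator (fun x => w x ^ r) z.2) volume :=
    h0.comp_snd
  have h3 : Measurable ((ball (0 : 𝔼) (2 * M)).indicator fun y => ‖y‖ ^ (γ - n)) :=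
    (by fun_prop : Measurable fun y : 𝔼 => ‖y‖ ^ (γ - n)).indicator measurableSet_ball
  exact (h1.add h2).mul (h3.comp (measurable_fst.sub measurable_snd)).aemeasurable

lemma aemeasurable_farError {V : Set 𝔼} (hV : MeasurableSet V) {f g : 𝔼 → ℝ}
    (hf : AEMeasurable f volume) (hg : AEMeasurable g volume) :
    AEMeasurable (farError V f g) volume := by
  have h0 : AEMeasurable (V.indicator f) volume := hf.indicator hV
  have h1 : AEMeasurable (fun z : 𝔼 × 𝔼 => V.indicator f z.1) volume := h0.comp_fst
  have h2 : AEMeasurable (fun z : 𝔼 × 𝔼 => V.indicator f z.2) volume := h0.comp_snd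
  have h3 : AEMeasurable (fun z : 𝔼 × 𝔼 => g z.1) volume := hg.comp_fst
  have h4 : AEMeasurable (fun z : 𝔼 × 𝔼 => g z.2) volume := hg.comp_snd
  exact (h1.mul h4).add (h2.mul h3)

lemma lintegral_ofReal_indicator {V : Set 𝔼} (hV : MeasurableSet V) (f : 𝔼 → ℝ) :
    ∫⁻ x, ENNReal.ofReal (V.indicator f x) = ∫⁻ x in V, ENNReal.ofReal (f x) := by
  rw [← lintegral_indicator hV]
  refine lintegral_congr fun x => ?_
  by_cases hx : x ∈ V <;> simp [hx]

lemma lintegral_nearError_le {V : Set 𝔼} (hV : MeasurableSet V) (M r γ : ℝ) {w : 𝔼 → ℝ}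
    (hw : AEMeasurable w volume) (hw0 : ∀ x, 0 ≤ w x) :
    ∫⁻ z, ENNReal.ofReal (nearError V M r γ w z) ≤
      2 * (∫⁻ y in ball (0 : 𝔼) (2 * M), ENNReal.ofReal (‖y‖ ^ (γ - n))) *
        ∫⁻ x in V, ENNReal.ofReal (w x ^ r) := by
  set k : 𝔼 → ℝ := (ball (0 : 𝔼) (2 * M)).indicator fun y => ‖y‖ ^ (γ - n) with hk
  have hkm : Measurable k :=
    (by fun_prop : Measurable fun y : 𝔼 => ‖y‖ ^ (γ - n)).indicator measurableSet_ball
  have hk0 : ∀ y, 0 ≤ k y := fun y => indicator_nonneg (fun x _ => by positivity) y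
  set W : 𝔼 → ℝ := V.indicator fun x => w x ^ r with hW
  have hW0 : ∀ x, 0 ≤ W x := indicator_nonneg fun x _ => Real.rpow_nonneg (hw0 x) _
  have hWm : AEMeasurable W volume := (hw.pow_const r).indicator hV
  rw [← lintegral_ofReal_indicator hV, ← lintegral_ofReal_indicator measurableSet_ball, ← hk, ← hW]
  have e1 : ∫⁻ z : 𝔼 × 𝔼, ENNReal.ofReal (W z.1) * ENNReal.ofReal (k (z.1 - z.2)) ≤
      (∫⁻ y, ENNReal.ofReal (k y)) * ∫⁻ x, ENNReal.ofReal (W x) := by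
    refine (lintegral_prod_le _).trans (le_of_eq ?_)
    rw [← lintegral_const_mul'' _ (by fun_prop)]
    refine lintegral_congr fun x => ?_
    dsimp only
    rw [lintegral_const_mul _ (by fun_prop), mul_comm,
      lintegral_sub_left_eq_self (fun y => ENNReal.ofReal (k y)) x]
  have e2 : ∫⁻ z : 𝔼 × 𝔼, ENNReal.ofReal (W z.2) * ENNReal.ofReal (k (z.1 - z.2)) ≤
      (∫⁻ y, ENNReal.ofReal (k y)) * ∫⁻ x, ENNReal.ofReal (W x) := by
    rw [Measure.volume_eq_prod, ← lintegral_prod_swap]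
    refine (lintegral_prod_le _).trans (le_of_eq ?_)
    rw [← lintegral_const_mul'' _ (by fun_prop)]
    refine lintegral_congr fun x => ?_
    simp only [Prod.fst_swap, Prod.snd_swap]
    rw [lintegral_const_mul _ (by fun_prop), mul_comm,
      lintegral_sub_right_eq_self (fun y => ENNReal.ofReal (k y)) x]
  have hsplit : ∀ z : 𝔼 × 𝔼, ENNReal.ofReal (nearError V M r γ w z) =
      ENNReal.ofReal (W z.1) * ENNReal.ofReal (k (z.1 - z.2)) +
        ENNReal.ofReal (W z.2) * ENNReal.ofReal (k (z.1 - z.2)) := fun z => by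
    rw [← add_mul, ← ENNReal.ofReal_add (hW0 _) (hW0 _),
      ← ENNReal.ofReal_mul (add_nonneg (hW0 _) (hW0 _))]
    rfl
  simp_rw [hsplit]
  have hWm1 : AEMeasurable (fun z : 𝔼 × 𝔼 => W z.1) volume := hWm.comp_fst
  rw [lintegral_add_left' (by fun_prop)]
  refine (add_le_add e1 e2).trans (le_of_eq (by ring))

lemma lintegral_farError_le {V : Set 𝔼} (hV : MeasurableSet V) {f g : 𝔼 → ℝ}
    (hf : AEMeasurable f volume) (hg : AEMeasurable g volume)
    (hf0 : ∀ x, 0 ≤ f x) (hg0 : ∀ x, 0 ≤ g x) :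
    ∫⁻ z, ENNReal.ofReal (farError V f g z) ≤
      2 * (∫⁻ y, ENNReal.ofReal (g y)) * ∫⁻ x in V, ENNReal.ofReal (f x) := by
  set W : 𝔼 → ℝ := V.indicator f with hW
  have hW0 : ∀ x, 0 ≤ W x := indicator_nonneg fun x _ => hf0 x
  have hWm : AEMeasurable W volume := hf.indicator hV
  rw [← lintegral_ofReal_indicator hV, ← hW]
  have hsplit : ∀ z : 𝔼 × 𝔼, ENNReal.ofReal (farError V f g z) =
      ENNReal.ofReal (W z.1) * ENNReal.ofReal (g z.2) +
        ENNReal.ofReal (g z.1) * ENNReal.ofReal (W z.2) := fun z => by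
    rw [← ENNReal.ofReal_mul (hW0 _), ← ENNReal.ofReal_mul (hg0 _), ← ENNReal.ofReal_add
      (mul_nonneg (hW0 _) (hg0 _)) (mul_nonneg (hg0 _) (hW0 _)), mul_comm (g z.1)]
    rfl
  simp_rw [hsplit]
  have hWm1 : AEMeasurable (fun z : 𝔼 × 𝔼 => W z.1) volume := hWm.comp_fst
  have hgm2 : AEMeasurable (fun z : 𝔼 × 𝔼 => g z.2) volume := hg.comp_snd
  rw [lintegral_add_left' (by fun_prop), Measure.volume_eq_prod,
    lintegral_prod_mul (f := fun x => ENNReal.ofReal (W x)) (g := fun y => ENNReal.ofReal (g y))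
      (by fun_prop) (by fun_prop),
    lintegral_prod_mul (f := fun x => ENNReal.ofReal (g x)) (g := fun y => ENNReal.ofReal (W y))
      (by fun_prop) (by fun_prop)]
  exact le_of_eq (by ring)

/-- Away from the diagonal the kernels are controlled by the weight `(1 + |y|)^{-e₀}`,
with a constant that is a power of the distance `h`. -/
lemma one_div_norm_sub_rpow_le {M h e e₀ N : ℝ} {x y : 𝔼} (hx : ‖x‖ ≤ M) (hh : 0 < h)
    (hh1 : h ≤ 1) (hxy : h ≤ ‖x - y‖) (he₀ : 0 ≤ e₀) (he : e₀ ≤ e) (heN : e ≤ N) :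
    1 / ‖x - y‖ ^ e ≤ ((2 + M) / h) ^ N * (1 / (1 + ‖y‖) ^ e₀) := by
  have hM : 0 ≤ M := (norm_nonneg x).trans hx
  have hy : 0 ≤ ‖y‖ := norm_nonneg y
  have h1 : 1 + ‖y‖ ≤ (2 + M) / h * ‖x - y‖ := by
    have hyx : ‖y‖ ≤ ‖x‖ + ‖x - y‖ := by
      have := norm_sub_le x (x - y)
      rwa [sub_sub_cancel] at this
    rw [div_mul_eq_mul_div, le_div_iff₀ hh]
    nlinarith [norm_nonneg (x - y)]
  have hc : 1 ≤ (2 + M) / h := by rw [le_div_iff₀ hh]; linarith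
  have hpos : 0 < ‖x - y‖ := hh.trans_le hxy
  rw [mul_one_div, div_le_div_iff₀ (by positivity) (by positivity), one_mul]
  calc (1 + ‖y‖) ^ e₀ ≤ (1 + ‖y‖) ^ e := Real.rpow_le_rpow_of_exponent_le (by linarith) he
    _ ≤ ((2 + M) / h * ‖x - y‖) ^ e := Real.rpow_le_rpow (by positivity) h1 (he₀.trans he)
    _ = ((2 + M) / h) ^ e * ‖x - y‖ ^ e := Real.mul_rpow (by positivity) (by positivity)
    _ ≤ _ := by
      gcongr

lemma add_rpow_le_two_rpow_mul {A B r : ℝ} (hA : 0 ≤ A) (hB : 0 ≤ B) (hr : 0 ≤ r) :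
    (A + B) ^ r ≤ 2 ^ r * (A ^ r + B ^ r) := by
  have hm : A + B ≤ 2 * max A B := by linarith [le_max_left A B, le_max_right A B]
  have h0 : 0 ≤ max A B := hA.trans (le_max_left _ _)
  calc (A + B) ^ r ≤ (2 * max A B) ^ r := Real.rpow_le_rpow (by positivity) hm hr
    _ = 2 ^ r * max A B ^ r := Real.mul_rpow (by norm_num) h0
    _ ≤ 2 ^ r * (A ^ r + B ^ r) := by
      gcongr
      rcases max_choice A B with h | h <;> rw [h]
      · linarith [Real.rpow_nonneg hB r]
      · linarith [Real.rpow_nonneg hA r]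

/-- The near kernel dominates `|x-y|^r / |x-y|^{n+α}`, also on the diagonal. -/
lemma norm_rpow_div_le {M r α : ℝ} {x y : 𝔼} (hx : ‖x‖ < M) (hy : ‖y‖ < M) :
    ‖x - y‖ ^ r / ‖x - y‖ ^ (n + α) ≤
      (ball (0 : 𝔼) (2 * M)).indicator (fun y => ‖y‖ ^ (r - α - n)) (x - y) := by
  have hmem : x - y ∈ ball (0 : 𝔼) (2 * M) := by
    rw [mem_ball_zero_iff]
    linarith [norm_sub_le x y]
  rw [indicator_of_mem hmem]
  rcases (norm_nonneg (x - y)).eq_or_lt with h0 | h0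
  · rw [← h0]
    rcases eq_or_ne ((n : ℝ) + α) 0 with he | he
    · rw [he, show r - α - n = r - (n + α) by ring, he]
      simp
    · rw [Real.zero_rpow he, div_zero]
      exact Real.rpow_nonneg le_rfl _
  · rw [← Real.rpow_sub h0]
    exact le_of_eq (by ring_nf)

/-- `ψ` is a cutoff supported in the sublevel set `{d < ρ}`: it takes values in `[0,1]`, is
Lipschitz with constant `L`, and vanishes where `d ≥ ρ`. -/
structure IsCutoff (d ψ : 𝔼 → ℝ) (ρ L : ℝ) : Prop where
  nonneg : ∀ x, 0 ≤ ψ x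
  le_one : ∀ x, ψ x ≤ 1
  lipschitz : ∀ x y, |ψ x - ψ y| ≤ L * ‖x - y‖
  eq_zero : ∀ x, ρ ≤ d x → ψ x = 0

/-- The pointwise Leibniz rule. Inside `V = {d < ρ + h}` the difference of `w ψ` splits into a
difference of `w` and one of `ψ`; a point off `V` has distance at least `h` to the support of
`ψ`. -/
lemma abs_mul_sub_mul_rpow_le {d ψ w : 𝔼 → ℝ} {ρ h L M α r N b B : ℝ}
    (hd : ∀ x y, d x - d y ≤ ‖x - y‖) (hM : ∀ x, d x < ρ + h → ‖x‖ < M)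
    (hψ : IsCutoff d ψ ρ L) (hL : 0 ≤ L) (hw : ∀ x, 0 ≤ w x) (hh : 0 < h) (hh1 : h ≤ 1)
    (hr : 0 < r) (hα : 0 ≤ α) (hN : n + α ≤ N) (hb : 0 ≤ b) (hbB : b ≤ B) (x y : 𝔼) :
    b * (|w x * ψ x - w y * ψ y| ^ r / ‖x - y‖ ^ (n + α)) ≤
      2 ^ r * (({x | d x < ρ + h} ×ˢ {x | d x < ρ + h}).indicator
        (fun z : 𝔼 × 𝔼 => b * (|w z.1 - w z.2| ^ r / ‖z.1 - z.2‖ ^ (n + α))) (x, y)) +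
      (B * 2 ^ r * L ^ r * nearError {x | d x < ρ + h} M r (r - α) w (x, y) +
      B * ((2 + M) / h) ^ N * farError {x | d x < ρ + h} (fun x => w x ^ r)
        (fun y => 1 / (1 + ‖y‖) ^ (n + α)) (x, y)) := by
  set V := {x | d x < ρ + h} with hV
  have hB : 0 ≤ B := hb.trans hbB
  have hnα : 0 ≤ n + α := by positivity
  have hnear := nearError_nonneg V M r (r - α) hw (x, y)
  have hfar := farError_nonneg V (f := fun x => w x ^ r)
    (g := fun y : 𝔼 => 1 / (1 + ‖y‖) ^ (n + α)) (fun x => Real.rpow_nonneg (hw x) _)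
    (fun y => by positivity) (x, y)
  have hψV : ∀ z, z ∉ V → ψ z = 0 := fun z hz => hψ.eq_zero z (by
    simp only [hV, mem_ofPred_eq, not_lt] at hz; linarith)
  -- the interaction of a point of `V` with a point off `V`
  have hmix : ∀ x y, x ∈ V → y ∉ V → b * (|w x * ψ x| ^ r / ‖x - y‖ ^ (n + α)) ≤
      B * ((2 + M) / h) ^ N * (w x ^ r * (1 / (1 + ‖y‖) ^ (n + α))) := by
    intro x y hx hy
    have hM0 : 0 ≤ M := (norm_nonneg x).trans (hM x hx).le
    have hwr : 0 ≤ w x ^ r := Real.rpow_nonneg (hw x) _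
    rcases le_or_gt ρ (d x) with hdx | hdx
    · rw [hψ.eq_zero x hdx, mul_zero, abs_zero, Real.zero_rpow hr.ne', zero_div, mul_zero]
      positivity
    · have hxy : h ≤ ‖x - y‖ := by
        simp only [hV, mem_ofPred_eq, not_lt] at hy
        have := hd y x
        rw [norm_sub_rev] at this
        linarith
      have h1 := one_div_norm_sub_rpow_le (hM x hx).le hh hh1 hxy hnα le_rfl hN
      have h2 : |w x * ψ x| ^ r ≤ w x ^ r := by
        rw [abs_of_nonneg (mul_nonneg (hw x) (hψ.nonneg x))]
        exact Real.rpow_le_rpow (mul_nonneg (hw x) (hψ.nonneg x))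
          (mul_le_of_le_one_right (hw x) (hψ.le_one x)) hr.le
      calc b * (|w x * ψ x| ^ r / ‖x - y‖ ^ (n + α))
          = b * (|w x * ψ x| ^ r * (1 / ‖x - y‖ ^ (n + α))) := by rw [mul_one_div]
        _ ≤ B * (w x ^ r * (((2 + M) / h) ^ N * (1 / (1 + ‖y‖) ^ (n + α)))) := by gcongr
        _ = _ := by ring
  by_cases hx : x ∈ V <;> by_cases hy : y ∈ V
  · have hM0 : 0 ≤ M := (norm_nonneg x).trans (hM x hx).le
    rw [indicator_of_mem (show (x, y) ∈ V ×ˢ V from ⟨hx, hy⟩)]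
    have h1 : |w x * ψ x - w y * ψ y| ≤ |w x - w y| + w y * (L * ‖x - y‖) := by
      have : w x * ψ x - w y * ψ y = (w x - w y) * ψ x + w y * (ψ x - ψ y) := by ring
      rw [this]
      refine (abs_add_le _ _).trans ?_
      rw [abs_mul, abs_mul, abs_of_nonneg (hw y), abs_of_nonneg (hψ.nonneg x)]
      have := hψ.lipschitz x y
      have := hw y
      gcongr
      exact mul_le_of_le_one_right (abs_nonneg _) (hψ.le_one x)
    have h2 : |w x * ψ x - w y * ψ y| ^ r ≤
        2 ^ r * (|w x - w y| ^ r + w y ^ r * (L ^ r * ‖x - y‖ ^ r)) := by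
      refine (Real.rpow_le_rpow (abs_nonneg _) h1 hr.le).trans ?_
      refine (add_rpow_le_two_rpow_mul (abs_nonneg _) (mul_nonneg (hw y) (by positivity))
        hr.le).trans (le_of_eq ?_)
      rw [Real.mul_rpow (hw y) (by positivity), Real.mul_rpow hL (norm_nonneg _)]
    have h3 : w y ^ r * (‖x - y‖ ^ r / ‖x - y‖ ^ (n + α)) ≤ nearError V M r (r - α) w (x, y) := by
      have hk := norm_rpow_div_le (r := r) (α := α) (hM x hx) (hM y hy)
      have hk0 : 0 ≤ (ball (0 : 𝔼) (2 * M)).indicator (fun y => ‖y‖ ^ (r - α - n)) (x - y) :=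
        indicator_nonneg (fun x _ => by positivity) _
      simp only [nearError, indicator_of_mem hx, indicator_of_mem hy]
      have := Real.rpow_nonneg (hw x) r
      have := Real.rpow_nonneg (hw y) r
      gcongr
      linarith
    calc b * (|w x * ψ x - w y * ψ y| ^ r / ‖x - y‖ ^ (n + α))
        ≤ b * (2 ^ r * (|w x - w y| ^ r + w y ^ r * (L ^ r * ‖x - y‖ ^ r)) /
            ‖x - y‖ ^ (n + α)) := by gcongr
      _ = 2 ^ r * (b * (|w x - w y| ^ r / ‖x - y‖ ^ (n + α))) +
          b * 2 ^ r * L ^ r * (w y ^ r * (‖x - y‖ ^ r / ‖x - y‖ ^ (n + α))) := by ring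
      _ ≤ 2 ^ r * (b * (|w x - w y| ^ r / ‖x - y‖ ^ (n + α))) +
          B * 2 ^ r * L ^ r * nearError V M r (r - α) w (x, y) := by
          have := Real.rpow_nonneg (hw y) r
          gcongr
      _ ≤ _ := by
          have : 0 ≤ B * ((2 + M) / h) ^ N * farError V (fun x => w x ^ r)
            (fun y : 𝔼 => 1 / (1 + ‖y‖) ^ (n + α)) (x, y) := by positivity
          linarith
  · have hM0 : 0 ≤ M := (norm_nonneg x).trans (hM x hx).le
    rw [indicator_of_notMem (fun h => hy h.2), hψV y hy, mul_zero, sub_zero]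
    have h1 := hmix x y hx hy
    have h2 : 0 ≤ B * 2 ^ r * L ^ r * nearError V M r (r - α) w (x, y) := by positivity
    simp only [farError, indicator_of_mem hx, indicator_of_notMem hy]
    linarith
  · have hM0 : 0 ≤ M := (norm_nonneg y).trans (hM y hy).le
    rw [indicator_of_notMem (fun h => hx h.1), hψV x hx, mul_zero, zero_sub, abs_neg,
      norm_sub_rev]
    have h1 := hmix y x hy hx
    have h2 : 0 ≤ B * 2 ^ r * L ^ r * nearError V M r (r - α) w (x, y) := by positivity
    simp only [farError, indicator_of_mem hy, indicator_of_notMem hx]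
    linarith
  · rw [indicator_of_notMem (fun h => hy h.2), hψV y hy, hψV x hx, mul_zero, mul_zero, sub_zero,
      abs_zero, Real.zero_rpow hr.ne', zero_div, mul_zero]
    have h2 : 0 ≤ B * 2 ^ r * L ^ r * nearError V M r (r - α) w (x, y) := by positivity
    simp only [farError, indicator_of_notMem hy, indicator_of_notMem hx]
    linarith

lemma lintegral_one_div_one_add_norm_lt_top {e : ℝ} (he : n < e) :
    ∫⁻ y : 𝔼, ENNReal.ofReal (1 / (1 + ‖y‖) ^ e) < ⊤ := by
  have := finite_integral_one_add_norm (E := 𝔼) (μ := volume) (r := e) (by simpa using he)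
  refine lt_of_le_of_lt (le_of_eq (lintegral_congr fun y => ?_)) this
  rw [Real.rpow_neg (by positivity), one_div]

/-- Cutting off costs a multiple of the `L^r` norm on the support:
the Leibniz rule for Gagliardo seminorms. -/
lemma gagliardo_mul_cutoff_le (hn : 0 < n) {M α r N B m : ℝ} (hα : 0 < α) (hαr : α < r)
    (hN : n + α ≤ N) (hrN : r ≤ N) (hm : 0 ≤ m) (hM0 : 0 ≤ M) (hB : 0 ≤ B) :
    ∃ C : ℝ≥0∞, C ≠ ⊤ ∧ ∀ (d ψ w : 𝔼 → ℝ) (ρ h : ℝ) (b : 𝔼 → 𝔼 → ℝ),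
      (∀ x y, d x - d y ≤ ‖x - y‖) → Measurable d → (∀ x, d x < ρ + h → ‖x‖ < M) →
      IsCutoff d ψ ρ (m / h) → (∀ x, 0 ≤ w x) → AEMeasurable w volume → 0 < h → h ≤ 1 →
      (∀ x y, 0 ≤ b x y) → (∀ᵐ z : 𝔼 × 𝔼, b z.1 z.2 ≤ B) →
      ∫⁻ z : 𝔼 × 𝔼, ENNReal.ofReal (b z.1 z.2 * (|w z.1 * ψ z.1 - w z.2 * ψ z.2| ^ r /
        ‖z.1 - z.2‖ ^ (n + α))) ≤
      ENNReal.ofReal (2 ^ r) * (∫⁻ z in {x | d x < ρ + h} ×ˢ {x | d x < ρ + h},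
        ENNReal.ofReal (b z.1 z.2 * (|w z.1 - w z.2| ^ r / ‖z.1 - z.2‖ ^ (n + α)))) +
      C * ENNReal.ofReal (h⁻¹ ^ N) * ∫⁻ x in {x | d x < ρ + h}, ENNReal.ofReal (w x ^ r) := by
  set A₁ : ℝ≥0∞ := ∫⁻ y in ball (0 : 𝔼) (2 * M), ENNReal.ofReal (‖y‖ ^ (r - α - n)) with hA₁
  set A₂ : ℝ≥0∞ := ∫⁻ y : 𝔼, ENNReal.ofReal (1 / (1 + ‖y‖) ^ (n + α)) with hA₂
  have hA₁t : A₁ ≠ ⊤ := (lintegral_ball_norm_rpow_lt_top hn (by linarith) _).ne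
  have hA₂t : A₂ ≠ ⊤ := (lintegral_one_div_one_add_norm_lt_top (by linarith)).ne
  refine ⟨ENNReal.ofReal (B * 2 ^ r * m ^ r) * (2 * A₁) +
    ENNReal.ofReal (B * (2 + M) ^ N) * (2 * A₂), ?_, ?_⟩
  · exact ENNReal.add_ne_top.2 ⟨ENNReal.mul_ne_top ENNReal.ofReal_ne_top
      (ENNReal.mul_ne_top (by simp) hA₁t), ENNReal.mul_ne_top ENNReal.ofReal_ne_top
      (ENNReal.mul_ne_top (by simp) hA₂t)⟩
  intro d ψ w ρ h b hd hdm hM hψ hw hwm hh hh1 hb hbB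
  set V := {x | d x < ρ + h} with hV
  have hVm : MeasurableSet V := measurableSet_lt hdm measurable_const
  have hr : 0 < r := hα.trans hαr
  set g : 𝔼 → ℝ := fun y => 1 / (1 + ‖y‖) ^ (n + α) with hg
  have hgm : AEMeasurable g volume := by fun_prop
  have hwr : AEMeasurable (fun x => w x ^ r) volume := by fun_prop
  have hnm := aemeasurable_nearError hVm M r (r - α) hwm
  have hfm := aemeasurable_farError hVm hwr hgm
  set K₁ : ℝ := B * 2 ^ r * (m / h) ^ r with hK₁
  set K₂ : ℝ := B * ((2 + M) / h) ^ N with hK₂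
  have hK₁0 : 0 ≤ K₁ := by positivity
  have hK₂0 : 0 ≤ K₂ := by positivity
  have hK₁le : K₁ ≤ B * 2 ^ r * m ^ r * h⁻¹ ^ N := by
    rw [hK₁, div_eq_mul_inv, Real.mul_rpow hm (by positivity), ← mul_assoc]
    gcongr
    exact (one_le_inv₀ hh).2 hh1
  have hK₂le : K₂ = B * (2 + M) ^ N * h⁻¹ ^ N := by
    rw [hK₂, div_eq_mul_inv, Real.mul_rpow (by positivity) (by positivity), ← mul_assoc]
  calc ∫⁻ z : 𝔼 × 𝔼, ENNReal.ofReal (b z.1 z.2 * (|w z.1 * ψ z.1 - w z.2 * ψ z.2| ^ r /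
        ‖z.1 - z.2‖ ^ (n + α)))
      ≤ ∫⁻ z : 𝔼 × 𝔼, (ENNReal.ofReal (2 ^ r) * (V ×ˢ V).indicator (fun z : 𝔼 × 𝔼 =>
          ENNReal.ofReal (b z.1 z.2 * (|w z.1 - w z.2| ^ r / ‖z.1 - z.2‖ ^ (n + α)))) z +
        (ENNReal.ofReal K₁ * ENNReal.ofReal (nearError V M r (r - α) w z) +
          ENNReal.ofReal K₂ * ENNReal.ofReal (farError V (fun x => w x ^ r) g z))) := by
        refine lintegral_mono_ae ?_
        filter_upwards [hbB] with z hz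
        refine (ENNReal.ofReal_le_ofReal (abs_mul_sub_mul_rpow_le hd hM hψ (by positivity) hw hh
          hh1 hr hα.le hN (hb z.1 z.2) hz z.1 z.2)).trans ?_
        have hn0 := nearError_nonneg V M r (r - α) hw z
        have hf0 := farError_nonneg V (f := fun x => w x ^ r) (g := g)
          (fun x => Real.rpow_nonneg (hw x) _) (fun y => by positivity) z
        refine ENNReal.ofReal_add_le.trans ?_
        refine add_le_add ?_ (ENNReal.ofReal_add_le.trans (le_of_eq ?_))
        · rw [ENNReal.ofReal_mul (by positivity)]
          gcongr
          by_cases hzV : z ∈ V ×ˢ V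
          · rw [indicator_of_mem (show (z.1, z.2) ∈ V ×ˢ V from hzV), indicator_of_mem hzV]
          · rw [indicator_of_notMem (show (z.1, z.2) ∉ V ×ˢ V from hzV)]
            simp
        · rw [← ENNReal.ofReal_mul hK₁0, ← ENNReal.ofReal_mul hK₂0]
    _ = ENNReal.ofReal (2 ^ r) * (∫⁻ z in V ×ˢ V, ENNReal.ofReal (b z.1 z.2 *
          (|w z.1 - w z.2| ^ r / ‖z.1 - z.2‖ ^ (n + α)))) +
        (ENNReal.ofReal K₁ * (∫⁻ z, ENNReal.ofReal (nearError V M r (r - α) w z)) +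
          ENNReal.ofReal K₂ * ∫⁻ z, ENNReal.ofReal (farError V (fun x => w x ^ r) g z)) := by
        rw [lintegral_add_right' _ (by fun_prop), lintegral_add_right' _ (by fun_prop),
          lintegral_const_mul' _ _ ENNReal.ofReal_ne_top,
          lintegral_const_mul' _ _ ENNReal.ofReal_ne_top,
          lintegral_const_mul' _ _ ENNReal.ofReal_ne_top,
          lintegral_indicator (hVm.prod hVm)]
    _ ≤ ENNReal.ofReal (2 ^ r) * (∫⁻ z in V ×ˢ V, ENNReal.ofReal (b z.1 z.2 *
          (|w z.1 - w z.2| ^ r / ‖z.1 - z.2‖ ^ (n + α)))) +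
        (ENNReal.ofReal (B * 2 ^ r * m ^ r * h⁻¹ ^ N) *
          (2 * A₁ * ∫⁻ x in V, ENNReal.ofReal (w x ^ r)) +
        ENNReal.ofReal (B * (2 + M) ^ N * h⁻¹ ^ N) *
          (2 * A₂ * ∫⁻ x in V, ENNReal.ofReal (w x ^ r))) := by
        rw [← hK₂le]
        gcongr
        · exact lintegral_nearError_le hVm M r (r - α) hwm hw
        · exact lintegral_farError_le hVm hwr hgm (fun x => Real.rpow_nonneg (hw x) _)
            (fun y => by positivity)
    _ = _ := by
        rw [ENNReal.ofReal_mul (p := B * 2 ^ r * m ^ r) (by positivity),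
          ENNReal.ofReal_mul (p := B * (2 + M) ^ N) (by positivity)]
        ring

/-! ### Cutoff functions and the local Sobolev inequality -/

/-- The piecewise linear cutoff, equal to `1` where `d ≤ ρ` and to `0` where `d ≥ ρ + h`. -/
def cutoff (d : 𝔼 → ℝ) (ρ h : ℝ) (x : 𝔼) : ℝ := max 0 (min 1 ((ρ + h - d x) / h))

lemma isCutoff_cutoff {d : 𝔼 → ℝ} (hd : ∀ x y, d x - d y ≤ ‖x - y‖) (ρ : ℝ) {h : ℝ}
    (hh : 0 < h) : IsCutoff d (cutoff d ρ h) (ρ + h) (1 / h) where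
  nonneg x := le_max_left _ _
  le_one x := max_le zero_le_one (min_le_left _ _)
  lipschitz x y := by
    have h1 : |cutoff d ρ h x - cutoff d ρ h y| ≤ |(ρ + h - d x) / h - (ρ + h - d y) / h| := by
      have e1 := abs_max_sub_max_le_max 0 (min 1 ((ρ + h - d x) / h)) 0
        (min 1 ((ρ + h - d y) / h))
      have e2 := abs_min_sub_min_le_max 1 ((ρ + h - d x) / h) 1 ((ρ + h - d y) / h)
      simp only [sub_self, abs_zero, abs_nonneg, sup_of_le_right] at e1 e2
      exact e1.trans e2
    refine h1.trans ?_
    rw [← sub_div, abs_div, abs_of_pos hh, one_div_mul_eq_div]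
    gcongr
    rw [abs_le]
    have := hd x y
    have h2 := hd y x
    rw [norm_sub_rev] at h2
    constructor <;> linarith
  eq_zero x hx := by
    refine max_eq_left ((min_le_right _ _).trans (div_nonpos_of_nonpos_of_nonneg ?_ hh.le))
    linarith

lemma cutoff_eq_one {d : 𝔼 → ℝ} {ρ h : ℝ} (hh : 0 < h) {x : 𝔼} (hx : d x ≤ ρ) :
    cutoff d ρ h x = 1 := by
  have : 1 ≤ (ρ + h - d x) / h := by rw [le_div_iff₀ hh]; linarith
  rw [cutoff, min_eq_left this, max_eq_right zero_le_one]

lemma rpow_sub_rpow_le {m a b : ℝ} (hm : 1 ≤ m) (ha : 0 ≤ a) (hab : a ≤ b) :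
    b ^ m - a ^ m ≤ m * b ^ (m - 1) * (b - a) := by
  rcases (ha.trans hab).eq_or_lt with hb | hb
  · have : a = 0 := le_antisymm (hab.trans hb.ge) ha
    simp [← hb, this]
  have h1 := one_add_mul_self_le_rpow_one_add (s := a / b - 1)
    (by linarith [div_nonneg ha hb.le]) hm
  rw [add_sub_cancel, Real.div_rpow ha hb.le] at h1
  have hbm : 0 < b ^ m := by positivity
  have h2 : (1 + m * (a / b - 1)) * b ^ m ≤ a ^ m := by rwa [le_div_iff₀ hbm] at h1
  have h3 : b ^ m = b ^ (m - 1) * b := by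
    rw [← Real.rpow_add_one hb.ne', sub_add_cancel]
  have h4 : (1 + m * (a / b - 1)) * b ^ m = b ^ m - m * b ^ (m - 1) * (b - a) := by
    rw [h3]
    field_simp
    ring
  linarith

lemma IsCutoff.rpow {d ψ : 𝔼 → ℝ} {ρ L m : ℝ} (hψ : IsCutoff d ψ ρ L) (hm : 1 ≤ m) :
    IsCutoff d (fun x => ψ x ^ m) ρ (m * L) where
  nonneg x := Real.rpow_nonneg (hψ.nonneg x) _
  le_one x := Real.rpow_le_one (hψ.nonneg x) (hψ.le_one x) (by linarith)
  lipschitz x y := by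
    have key : ∀ x y, ψ y ≤ ψ x → |ψ x ^ m - ψ y ^ m| ≤ m * L * ‖x - y‖ := by
      intro x y hxy
      rw [abs_of_nonneg (sub_nonneg.2 (Real.rpow_le_rpow (hψ.nonneg y) hxy (by linarith)))]
      have h1 := rpow_sub_rpow_le hm (hψ.nonneg y) hxy
      have h2 : ψ x ^ (m - 1) ≤ 1 := Real.rpow_le_one (hψ.nonneg x) (hψ.le_one x) (by linarith)
      have h3 : ψ x - ψ y ≤ L * ‖x - y‖ := (le_abs_self _).trans (hψ.lipschitz x y)
      calc _ ≤ _ := h1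
        _ ≤ m * 1 * (L * ‖x - y‖) := by
          gcongr
        _ = _ := by ring
    rcases le_total (ψ y) (ψ x) with hxy | hxy
    · exact key x y hxy
    · rw [abs_sub_comm, norm_sub_rev]
      exact key y x hxy
  eq_zero x hx := by rw [hψ.eq_zero x hx, Real.zero_rpow (by linarith)]

/-- The local fractional Sobolev inequality. The exponent `κ` may be smaller than the critical
exponent of the seminorm of order `α / p`. -/
lemma local_fractional_sobolev (hn : 0 < n) {M α p κ N : ℝ} (hp : 0 < p) (hpκ : p < κ)
    (hα : n * (1 - p / κ) ≤ α) (hαp : α < p) (hN : n + α ≤ N) (hpN : p ≤ N) (hM0 : 0 < M) :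
    ∃ C : ℝ≥0∞, C ≠ ⊤ ∧ ∀ (d w : 𝔼 → ℝ) (ρ h : ℝ),
      (∀ x y, d x - d y ≤ ‖x - y‖) → Measurable d → (∀ x, d x < ρ + 2 * h → ‖x‖ < M) →
      (∀ x, 0 ≤ w x) → AEMeasurable w volume → 0 < h → h ≤ 1 →
      ∫⁻ x in {x | d x < ρ}, ENNReal.ofReal (w x ^ κ) ≤
        (C * ((∫⁻ z in {x | d x < ρ + 2 * h} ×ˢ {x | d x < ρ + 2 * h},
          ENNReal.ofReal (|w z.1 - w z.2| ^ p / ‖z.1 - z.2‖ ^ (n + α))) +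
          ENNReal.ofReal (h⁻¹ ^ N) *
            ∫⁻ x in {x | d x < ρ + 2 * h}, ENNReal.ofReal (w x ^ p))) ^ (κ / p) := by
  have hκ : 0 < κ := hp.trans hpκ
  set β : ℝ := n * (1 - p / κ) with hβ
  have hβ0 : 0 < β := by
    have : p / κ < 1 := (div_lt_one hκ).2 hpκ
    have hn' : (0 : ℝ) < n := by exact_mod_cast hn
    exact mul_pos hn' (by linarith)
  obtain ⟨C₁, hC₁, h1⟩ := fractional_sobolev (n := n) hn hp hpκ
  obtain ⟨C₂, hC₂, h2⟩ := gagliardo_mul_cutoff_le (n := n) (M := M) (α := β) (r := p) (N := N)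
    (B := 1) (m := 1) hn hβ0 (by linarith) (by linarith) hpN zero_le_one hM0.le zero_le_one
  set c : ℝ := (2 * M) ^ (α - β) with hc
  refine ⟨C₁ * (ENNReal.ofReal (2 ^ p) * ENNReal.ofReal c + C₂),
    ENNReal.mul_ne_top hC₁ (ENNReal.add_ne_top.2 ⟨ENNReal.mul_ne_top ENNReal.ofReal_ne_top
      ENNReal.ofReal_ne_top, hC₂⟩), fun d w ρ h hd hdm hM hw hwm hh hh1 => ?_⟩
  set V := {x | d x < ρ + 2 * h} with hV
  have hV' : {x | d x < ρ + h + h} = V := by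
    rw [hV]; congr 1; ext x; rw [add_assoc, two_mul]
  have hVm : MeasurableSet V := measurableSet_lt hdm measurable_const
  have hψ := isCutoff_cutoff hd ρ hh
  set ψ := cutoff d ρ h with hψd
  have hψm : Measurable ψ := by
    rw [hψd]; unfold cutoff; fun_prop
  have hS := h1 (fun x => w x * ψ x) (fun x => mul_nonneg (hw x) (hψ.nonneg x)) (by fun_prop)
    ⟨V, ?_, fun x hx => ?_⟩
  · have hL := h2 d ψ w (ρ + h) h (fun _ _ => 1) hd hdm
      (fun x hx => hM x (by linarith)) hψ hw hwm hh hh1 (fun _ _ => zero_le_one)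
      (ae_of_all _ fun _ => le_rfl)
    simp only [one_mul, hV'] at hL
    set G := ∫⁻ z in V ×ˢ V, ENNReal.ofReal (|w z.1 - w z.2| ^ p / ‖z.1 - z.2‖ ^ (n + α)) with hG
    set P := ENNReal.ofReal (h⁻¹ ^ N) * ∫⁻ x in V, ENNReal.ofReal (w x ^ p) with hP
    have hcmp : ∫⁻ z in V ×ˢ V, ENNReal.ofReal (|w z.1 - w z.2| ^ p / ‖z.1 - z.2‖ ^ (n + β)) ≤
        ENNReal.ofReal c * G := by
      rw [hG, ← lintegral_const_mul' _ _ ENNReal.ofReal_ne_top]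
      refine setLIntegral_mono' (hVm.prod hVm) fun z hz => ?_
      rw [← ENNReal.ofReal_mul (by positivity)]
      refine ENNReal.ofReal_le_ofReal ?_
      rcases (norm_nonneg (z.1 - z.2)).eq_or_lt with h0 | h0
      · have : z.1 - z.2 = 0 := norm_eq_zero.1 h0.symm
        rw [sub_eq_zero] at this
        simp [this, Real.zero_rpow hp.ne']
      · have hlt : ‖z.1 - z.2‖ ≤ 2 * M := by
          linarith [norm_sub_le z.1 z.2, hM z.1 hz.1, hM z.2 hz.2]
        have : ‖z.1 - z.2‖ ^ (n + α) = ‖z.1 - z.2‖ ^ (n + β) * ‖z.1 - z.2‖ ^ (α - β) := by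
          rw [← Real.rpow_add h0]; ring_nf
        rw [this, hc, mul_div_assoc', div_le_div_iff₀ (by positivity) (by positivity)]
        have hle : ‖z.1 - z.2‖ ^ (α - β) ≤ (2 * M) ^ (α - β) :=
          Real.rpow_le_rpow h0.le hlt (by linarith)
        calc |w z.1 - w z.2| ^ p * (‖z.1 - z.2‖ ^ (n + β) * ‖z.1 - z.2‖ ^ (α - β))
            ≤ |w z.1 - w z.2| ^ p * (‖z.1 - z.2‖ ^ (n + β) * (2 * M) ^ (α - β)) := by gcongr
          _ = _ := by ring
    calc ∫⁻ x in {x | d x < ρ}, ENNReal.ofReal (w x ^ κ)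
        ≤ ∫⁻ x in {x | d x < ρ}, ENNReal.ofReal ((w x * ψ x) ^ κ) := by
          refine setLIntegral_mono' (measurableSet_lt hdm measurable_const) fun x hx => ?_
          rw [hψd, cutoff_eq_one hh (le_of_lt hx), mul_one]
      _ ≤ ∫⁻ x, ENNReal.ofReal ((w x * ψ x) ^ κ) := setLIntegral_le_lintegral _ _
      _ ≤ _ := hS
      _ ≤ _ := by
        refine ENNReal.rpow_le_rpow ?_ (by positivity)
        rw [mul_assoc]
        gcongr C₁ * ?_
        refine hL.trans ?_
        rw [mul_assoc C₂, ← hP]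
        calc _ ≤ ENNReal.ofReal (2 ^ p) * (ENNReal.ofReal c * G) + C₂ * P := by gcongr
          _ ≤ ENNReal.ofReal (2 ^ p) * (ENNReal.ofReal c * (G + P)) + C₂ * (G + P) := by
            gcongr
            · exact le_self_add
            · exact le_add_self
          _ = _ := by ring
  · refine ne_top_of_le_ne_top (measure_ball_lt_top (x := (0 : 𝔼)) (r := M)).ne
      (measure_mono fun x hx => ?_)
    rw [mem_ball_zero_iff]
    exact hM x hx
  · rw [hψ.eq_zero x (by simp only [hV, mem_ofPred_eq, not_lt] at hx; linarith), mul_zero]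

/-! ### The pointwise Caccioppoli inequality -/

lemma abs_rpow_mul_self {r τ : ℝ} (hr : 1 < r) (hτ : 0 ≤ τ) :
    |τ| ^ (r - 2) * τ = τ ^ (r - 1) := by
  rcases hτ.eq_or_lt with h | h
  · simp [← h, Real.zero_rpow (show r - 1 ≠ 0 by linarith)]
  · rw [abs_of_pos h, ← Real.rpow_add_one h.ne']
    congr 1
    ring

/-- The flux `|τ|^{r-2} τ` tested with the truncation `w = (u - k)₊` times a power of a cutoff
is bounded below by minus the term in which the cutoff is differentiated. -/
lemma flux_mul_sub_ge {r m u₁ u₂ k η₁ η₂ : ℝ} (hr : 1 < r) (hrm : r ≤ m)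
    (h₁ : 0 ≤ η₁) (h₁' : η₁ ≤ 1) (h₂ : 0 ≤ η₂) (h₂' : η₂ ≤ 1) :
    -(m ^ r * (max (u₁ - k) 0 ^ r + max (u₂ - k) 0 ^ r) * |η₁ - η₂| ^ r) ≤
      |u₁ - u₂| ^ (r - 2) * (u₁ - u₂) *
        (max (u₁ - k) 0 * η₁ ^ m - max (u₂ - k) 0 * η₂ ^ m) := by
  wlog hu : u₂ ≤ u₁ generalizing u₁ u₂ η₁ η₂ with H
  · have := H h₂ h₂' h₁ h₁' (le_of_not_ge hu)
    rw [abs_sub_comm u₂, abs_sub_comm η₂] at this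
    linarith
  have hm : 1 ≤ m := by linarith
  set w₁ := max (u₁ - k) 0 with hw₁
  set w₂ := max (u₂ - k) 0 with hw₂
  have hw₁0 : 0 ≤ w₁ := le_max_right _ _
  have hw₂0 : 0 ≤ w₂ := le_max_right _ _
  have hw : w₂ ≤ w₁ := max_le_max (by linarith) le_rfl
  rw [abs_rpow_mul_self hr (by linarith)]
  have hE : -(m ^ r * (w₁ ^ r + w₂ ^ r) * |η₁ - η₂| ^ r) ≤ 0 := by
    have : 0 ≤ m ^ r * (w₁ ^ r + w₂ ^ r) * |η₁ - η₂| ^ r := by positivity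
    linarith
  have hδ : 0 ≤ u₁ - u₂ := by linarith
  have hpow₁ : 0 ≤ η₁ ^ m := Real.rpow_nonneg h₁ _
  have hpow₂ : 0 ≤ η₂ ^ m := Real.rpow_nonneg h₂ _
  rcases le_or_gt η₂ η₁ with hη | hη
  · have : η₂ ^ m ≤ η₁ ^ m := Real.rpow_le_rpow h₂ hη (by linarith)
    have : 0 ≤ w₁ * η₁ ^ m - w₂ * η₂ ^ m := by
      have : w₂ * η₂ ^ m ≤ w₁ * η₁ ^ m := by gcongr
      linarith
    exact hE.trans (mul_nonneg (Real.rpow_nonneg hδ _) this)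
  rcases hw₂0.eq_or_lt with h0 | h0
  · refine hE.trans (mul_nonneg (Real.rpow_nonneg hδ _) ?_)
    rw [← h0, zero_mul, sub_zero]
    positivity
  -- both values lie above the level, so that `w₁ - w₂ = u₁ - u₂`
  have hw₂e : w₂ = u₂ - k := by
    rcases le_total (u₂ - k) 0 with h | h
    · rw [hw₂, max_eq_right h] at h0; exact absurd h0 (lt_irrefl _)
    · rw [hw₂, max_eq_left h]
  have hw₁e : w₁ = u₁ - k := by
    rw [hw₁, max_eq_left (by linarith)]
  have hη₂ : 0 < η₂ := h₁.trans_lt hη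
  set δ := u₁ - u₂ with hδd
  have hdiff := rpow_sub_rpow_le hm h₁ hη.le
  have hφ : w₁ * η₁ ^ m - w₂ * η₂ ^ m = δ * η₂ ^ m - w₁ * (η₂ ^ m - η₁ ^ m) := by
    rw [hw₁e, hw₂e]; ring
  have hη2m : η₂ ^ m = η₂ ^ (m - 1) * η₂ := by
    rw [← Real.rpow_add_one hη₂.ne', sub_add_cancel]
  set Q := m * w₁ * (η₂ - η₁) with hQ
  have hQ0 : 0 ≤ Q := mul_nonneg (mul_nonneg (by linarith) hw₁0) (by linarith)
  have hφ2 : η₂ ^ (m - 1) * (δ * η₂ - Q) ≤ w₁ * η₁ ^ m - w₂ * η₂ ^ m := by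
    rw [hφ, hη2m, hQ]
    have := mul_le_mul_of_nonneg_left hdiff hw₁0
    rw [hη2m] at this
    linarith
  have hpm : 0 < η₂ ^ (m - 1) := by positivity
  rcases le_or_gt Q (δ * η₂) with hc | hc
  · refine hE.trans (mul_nonneg (Real.rpow_nonneg hδ _) (le_trans ?_ hφ2))
    exact mul_nonneg hpm.le (by linarith)
  · -- `δ η₂ < Q`: the flux itself is controlled by the differentiated cutoff
    have hQpos : 0 < Q := (mul_nonneg hδ hη₂.le).trans_lt hc
    have e1 : δ ^ (r - 1) * η₂ ^ (m - 1) ≤ Q ^ (r - 1) := by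
      calc δ ^ (r - 1) * η₂ ^ (m - 1) ≤ δ ^ (r - 1) * η₂ ^ (r - 1) := by
            gcongr δ ^ (r - 1) * ?_
            exact Real.rpow_le_rpow_of_exponent_ge hη₂ h₂' (by linarith)
        _ = (δ * η₂) ^ (r - 1) := (Real.mul_rpow hδ hη₂.le).symm
        _ ≤ Q ^ (r - 1) := Real.rpow_le_rpow (by positivity) hc.le (by linarith)
    have e2 : δ ^ (r - 1) * η₂ ^ (m - 1) * Q ≤ Q ^ r := by
      calc _ ≤ Q ^ (r - 1) * Q := by gcongr
        _ = Q ^ r := by rw [← Real.rpow_add_one hQpos.ne', sub_add_cancel]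
    have e3 : Q ^ r ≤ m ^ r * (w₁ ^ r + w₂ ^ r) * |η₁ - η₂| ^ r := by
      rw [hQ, abs_sub_comm, abs_of_pos (sub_pos.2 hη), Real.mul_rpow (by positivity) (by linarith),
        Real.mul_rpow (by linarith) hw₁0]
      have : 0 ≤ w₂ ^ r := by positivity
      have : 0 ≤ (η₂ - η₁) ^ r := Real.rpow_nonneg (by linarith) _
      gcongr
      linarith
    have e4 : δ ^ (r - 1) * (η₂ ^ (m - 1) * (δ * η₂ - Q)) ≤
        δ ^ (r - 1) * (w₁ * η₁ ^ m - w₂ * η₂ ^ m) := by gcongr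
    have e5 : 0 ≤ δ ^ (r - 1) * (η₂ ^ (m - 1) * (δ * η₂)) := by positivity
    have e6 : δ ^ (r - 1) * (η₂ ^ (m - 1) * (δ * η₂ - Q)) =
      δ ^ (r - 1) * (η₂ ^ (m - 1) * (δ * η₂)) - δ ^ (r - 1) * η₂ ^ (m - 1) * Q := by ring
    linarith

/-- Where the cutoff is `1`, the flux tested with the truncation dominates the energy density of the
truncation. -/
lemma abs_sub_rpow_le_flux_mul_sub {r u₁ u₂ k : ℝ} (hr : 1 < r) :
    |max (u₁ - k) 0 - max (u₂ - k) 0| ^ r ≤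
      |u₁ - u₂| ^ (r - 2) * (u₁ - u₂) * (max (u₁ - k) 0 - max (u₂ - k) 0) := by
  wlog hu : u₂ ≤ u₁ generalizing u₁ u₂ with H
  · have := H (le_of_not_ge hu)
    rw [abs_sub_comm u₂, abs_sub_comm (max (u₂ - k) 0)] at this
    linarith
  have hw : max (u₂ - k) 0 ≤ max (u₁ - k) 0 := max_le_max (by linarith) le_rfl
  have hle : max (u₁ - k) 0 - max (u₂ - k) 0 ≤ u₁ - u₂ := by
    have := abs_max_sub_max_le_abs (u₁ - k) (u₂ - k) 0
    rw [abs_of_nonneg (sub_nonneg.2 hw), sub_sub_sub_cancel_right,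
      abs_of_nonneg (by linarith)] at this
    exact this
  rw [abs_rpow_mul_self hr (by linarith), abs_of_nonneg (sub_nonneg.2 hw)]
  rcases (sub_nonneg.2 hw).eq_or_lt with h | h
  · simp [← h, Real.zero_rpow (show r ≠ 0 by linarith)]
  · calc (max (u₁ - k) 0 - max (u₂ - k) 0) ^ r
        = (max (u₁ - k) 0 - max (u₂ - k) 0) ^ (r - 1) * (max (u₁ - k) 0 - max (u₂ - k) 0) := by
          rw [← Real.rpow_add_one h.ne', sub_add_cancel]
      _ ≤ _ := by gcongr

/-- The interaction with a point where the test function vanishes. Only the case `u₂ > u₁ > k` has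
the wrong sign, and there `u₂ - u₁ ≤ |u₂|`. -/
lemma flux_mul_truncation_ge {r u₁ u₂ k c : ℝ} (hr : 1 < r) (hk : 0 ≤ k) (hc : 0 ≤ c)
    (hc1 : c ≤ 1) :
    -(max (u₁ - k) 0 * |u₂| ^ (r - 1)) ≤
      |u₁ - u₂| ^ (r - 2) * (u₁ - u₂) * (max (u₁ - k) 0 * c) := by
  have hw0 : 0 ≤ max (u₁ - k) 0 := le_max_right _ _
  rcases le_total u₂ u₁ with hu | hu
  · rw [abs_rpow_mul_self hr (by linarith)]
    have h1 : 0 ≤ (u₁ - u₂) ^ (r - 1) := Real.rpow_nonneg (by linarith) _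
    have h2 : 0 ≤ max (u₁ - k) 0 * |u₂| ^ (r - 1) := by positivity
    have h3 := mul_nonneg h1 (mul_nonneg hw0 hc)
    linarith
  · have e : |u₁ - u₂| ^ (r - 2) * (u₁ - u₂) = -((u₂ - u₁) ^ (r - 1)) := by
      rw [← abs_rpow_mul_self hr (by linarith : 0 ≤ u₂ - u₁), abs_sub_comm]
      ring
    rw [e]
    rcases hw0.eq_or_lt with h0 | h0
    · simp [← h0]
    · have hu₁ : k < u₁ := by
        by_contra! hcon
        rw [max_eq_right (by linarith)] at h0
        exact lt_irrefl _ h0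
      have h1 : (u₂ - u₁) ^ (r - 1) ≤ |u₂| ^ (r - 1) := by
        refine Real.rpow_le_rpow (by linarith) ?_ (by linarith)
        exact le_trans (by linarith) (le_abs_self u₂)
      have h2 : 0 ≤ (u₂ - u₁) ^ (r - 1) := Real.rpow_nonneg (by linarith) _
      have h3 : (u₂ - u₁) ^ (r - 1) * (max (u₁ - k) 0 * c) ≤
          |u₂| ^ (r - 1) * (max (u₁ - k) 0 * 1) := by gcongr
      linarith

/-- One phase of the weak formulation, tested with `(u - k)₊ η^m`, dominates the energy density
of the truncation where `η = 1`, up to errors that contain no differences of `u`. -/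
lemma indicator_le_phase_add_error {d η u : 𝔼 → ℝ} {U : Set 𝔼} {ρ h L M α α₀ r m N b B K Λ k : ℝ}
    (hd : ∀ x y, d x - d y ≤ ‖x - y‖) (hM : ∀ x, d x < ρ + h → ‖x‖ < M)
    (hη : IsCutoff d η ρ L) (hL : 0 ≤ L) (hU : ∀ x ∈ U, η x = 1) (hh : 0 < h) (hh1 : h ≤ 1)
    (hr : 1 < r) (hrm : r ≤ m) (hα₀ : 0 ≤ α₀) (hα : α₀ ≤ α) (hN : n + α ≤ N)
    (hb : 0 ≤ b) (hbB : b ≤ B) (hΛ : 0 ≤ Λ) (hk : 0 ≤ k) (x y : 𝔼)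
    (hK0 : 0 ≤ K) (hK : K ≤ Λ / ‖x - y‖ ^ (n + α)) :
    (U ×ˢ U).indicator
      (fun z : 𝔼 × 𝔼 => b * (|max (u z.1 - k) 0 - max (u z.2 - k) 0| ^ r * K)) (x, y) ≤
    b * (|u x - u y| ^ (r - 2) * (u x - u y) *
        (max (u x - k) 0 * η x ^ m - max (u y - k) 0 * η y ^ m) * K) +
      (B * Λ * m ^ r * L ^ r *
        nearError {x | d x < ρ + h} M r (r - α) (fun x => max (u x - k) 0) (x, y) +
      B * Λ * ((2 + M) / h) ^ N * farError {x | d x < ρ + h} (fun x => max (u x - k) 0)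
        (fun y => |u y| ^ (r - 1) / (1 + ‖y‖) ^ (n + α₀)) (x, y)) := by
  set V := {x | d x < ρ + h} with hV
  set w : 𝔼 → ℝ := fun x => max (u x - k) 0 with hw
  set g : 𝔼 → ℝ := fun y => |u y| ^ (r - 1) / (1 + ‖y‖) ^ (n + α₀) with hg
  have hw0 : ∀ x, 0 ≤ w x := fun x => le_max_right _ _
  have hB : 0 ≤ B := hb.trans hbB
  have hm : 0 < m := by linarith
  have hnear := nearError_nonneg V M r (r - α) hw0 (x, y)
  have hfar := farError_nonneg V (f := w) (g := g) hw0 (fun y => by positivity) (x, y)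
  have hηV : ∀ z, z ∉ V → η z = 0 := fun z hz => hη.eq_zero z (by
    simp only [hV, mem_ofPred_eq, not_lt] at hz; linarith)
  have hUV : U ⊆ V := fun z hz => by
    by_contra hzV
    have := hU z hz
    rw [hηV z hzV] at this
    exact zero_ne_one this
  have hfac : V.Nonempty → 0 ≤ B * Λ * ((2 + M) / h) ^ N := fun ⟨z, hz⟩ => by
    have hM0 : 0 ≤ M := (norm_nonneg z).trans (hM z hz).le
    positivity
  have hfac2 : 0 ≤ B * Λ * m ^ r * L ^ r * nearError V M r (r - α) w (x, y) := by positivity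
  -- the interaction of a point of `V` with a point off `V`
  have hmix : ∀ x y, x ∈ V → y ∉ V → K ≤ Λ / ‖x - y‖ ^ (n + α) →
      -(B * Λ * ((2 + M) / h) ^ N * (w x * g y)) ≤
        b * (|u x - u y| ^ (r - 2) * (u x - u y) * (w x * η x ^ m) * K) := by
    intro x y hx hy hK
    have hM0 : 0 ≤ M := (norm_nonneg x).trans (hM x hx).le
    have hwx := hw0 x
    have hgy : 0 ≤ g y := by positivity
    rcases le_or_gt ρ (d x) with hdx | hdx
    · rw [hη.eq_zero x hdx, Real.zero_rpow hm.ne', mul_zero, mul_zero, zero_mul, mul_zero]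
      have : 0 ≤ B * Λ * ((2 + M) / h) ^ N * (w x * g y) := by positivity
      linarith
    · have hxy : h ≤ ‖x - y‖ := by
        simp only [hV, mem_ofPred_eq, not_lt] at hy
        have := hd y x
        rw [norm_sub_rev] at this
        linarith
      have h1 := one_div_norm_sub_rpow_le (N := N) (hM x hx).le hh hh1 hxy
        (show 0 ≤ n + α₀ by positivity) (show (n : ℝ) + α₀ ≤ n + α by linarith) hN
      have h2 := flux_mul_truncation_ge (r := r) (u₁ := u x) (u₂ := u y) hr hk
        (Real.rpow_nonneg (hη.nonneg x) m) (Real.rpow_le_one (hη.nonneg x) (hη.le_one x) hm.le)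
      have h3 : b * (w x * |u y| ^ (r - 1) * K) ≤
          B * (w x * |u y| ^ (r - 1) * (Λ * (((2 + M) / h) ^ N * (1 / (1 + ‖y‖) ^ (n + α₀))))) := by
        gcongr
        refine hK.trans ?_
        rw [← mul_one_div]
        gcongr
      have h4 : b * (-(w x * |u y| ^ (r - 1)) * K) ≤
          b * (|u x - u y| ^ (r - 2) * (u x - u y) * (w x * η x ^ m) * K) := by gcongr
      have h5 : B * (w x * |u y| ^ (r - 1) * (Λ * (((2 + M) / h) ^ N *
          (1 / (1 + ‖y‖) ^ (n + α₀))))) = B * Λ * ((2 + M) / h) ^ N * (w x * g y) := by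
        rw [hg]; ring
      linarith
  by_cases hxU : (x, y) ∈ U ×ˢ U
  · rw [indicator_of_mem hxU, hU x hxU.1, hU y hxU.2, Real.one_rpow, mul_one, mul_one]
    have h1 := abs_sub_rpow_le_flux_mul_sub (u₁ := u x) (u₂ := u y) (k := k) hr
    have h2 : b * (|max (u x - k) 0 - max (u y - k) 0| ^ r * K) ≤
        b * (|u x - u y| ^ (r - 2) * (u x - u y) *
          (max (u x - k) 0 - max (u y - k) 0) * K) := by gcongr
    have h3 := mul_nonneg (hfac ⟨x, hUV hxU.1⟩) hfar
    linarith
  rw [indicator_of_notMem hxU]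
  by_cases hx : x ∈ V <;> by_cases hy : y ∈ V
  · have h1 := flux_mul_sub_ge (u₁ := u x) (u₂ := u y) (k := k) hr hrm (hη.nonneg x)
      (hη.le_one x) (hη.nonneg y) (hη.le_one y)
    have h2 : b * (-(m ^ r * (w x ^ r + w y ^ r) * |η x - η y| ^ r) * K) ≤
        b * (|u x - u y| ^ (r - 2) * (u x - u y) * (w x * η x ^ m - w y * η y ^ m) * K) := by
      gcongr
    have hwr : 0 ≤ w x ^ r + w y ^ r :=
      add_nonneg (Real.rpow_nonneg (hw0 x) _) (Real.rpow_nonneg (hw0 y) _)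
    have h3 : (w x ^ r + w y ^ r) * (‖x - y‖ ^ r / ‖x - y‖ ^ (n + α)) ≤
        nearError V M r (r - α) w (x, y) := by
      have hk := norm_rpow_div_le (r := r) (α := α) (hM x hx) (hM y hy)
      simp only [nearError, indicator_of_mem hx, indicator_of_mem hy]
      gcongr
    have h4 : |η x - η y| ^ r ≤ L ^ r * ‖x - y‖ ^ r := by
      rw [← Real.mul_rpow hL (norm_nonneg _)]
      exact Real.rpow_le_rpow (abs_nonneg _) (hη.lipschitz x y) (by linarith)
    have h5 : b * (m ^ r * (w x ^ r + w y ^ r) * |η x - η y| ^ r * K) ≤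
        B * Λ * m ^ r * L ^ r * nearError V M r (r - α) w (x, y) := by
      calc b * (m ^ r * (w x ^ r + w y ^ r) * |η x - η y| ^ r * K)
          ≤ B * (m ^ r * (w x ^ r + w y ^ r) * (L ^ r * ‖x - y‖ ^ r) *
              (Λ / ‖x - y‖ ^ (n + α))) := by gcongr
        _ = B * Λ * m ^ r * L ^ r *
            ((w x ^ r + w y ^ r) * (‖x - y‖ ^ r / ‖x - y‖ ^ (n + α))) := by ring
        _ ≤ _ := by gcongr
    have h6 := mul_nonneg (hfac ⟨x, hx⟩) hfar
    linarith
  · have h1 := hmix x y hx hy hK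
    rw [hηV y hy, Real.zero_rpow hm.ne', mul_zero, sub_zero]
    have h2 : farError V w g (x, y) = w x * g y := by
      simp [farError, indicator_of_mem hx, indicator_of_notMem hy]
    rw [h2]
    linarith
  · have h1 := hmix y x hy hx (by rwa [norm_sub_rev])
    rw [hηV x hx, Real.zero_rpow hm.ne', mul_zero, zero_sub]
    have h2 : farError V w g (x, y) = w y * g x := by
      simp [farError, indicator_of_mem hy, indicator_of_notMem hx]
    rw [h2]
    rw [abs_sub_comm] at h1
    linarith
  · rw [hηV y hy, hηV x hx, Real.zero_rpow hm.ne', mul_zero, mul_zero, sub_zero, mul_zero,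
      zero_mul, mul_zero]
    have h2 : farError V w g (x, y) = 0 := by
      simp [farError, indicator_of_notMem hy, indicator_of_notMem hx]
    rw [h2]
    linarith

/-! ### Admissible test functions and the Caccioppoli inequality -/

lemma rpow_sub_one_mul_le {r A B : ℝ} (hr : 1 < r) (hA : 0 ≤ A) (hB : 0 ≤ B) :
    A ^ (r - 1) * B ≤ A ^ r + B ^ r := by
  have key : ∀ c : ℝ, 0 ≤ c → c ^ (r - 1) * c = c ^ r := fun c hc => by
    rcases hc.eq_or_lt with h | h
    · simp [← h, Real.zero_rpow (show r ≠ 0 by linarith)]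
    · rw [← Real.rpow_add_one h.ne', sub_add_cancel]
  have hAr := Real.rpow_nonneg hA r
  have hBr := Real.rpow_nonneg hB r
  rcases le_total A B with h | h
  · calc A ^ (r - 1) * B ≤ B ^ (r - 1) * B := by gcongr
      _ ≤ _ := by rw [key B hB]; linarith
  · calc A ^ (r - 1) * B ≤ A ^ (r - 1) * A := by gcongr
      _ ≤ _ := by rw [key A hA]; linarith

/-- Each phase of the weak formulation is integrable when `u` and `φ` have finite energy, by
Young's inequality. -/
lemma integrableOn_phase {S : Set (𝔼 × 𝔼)} {u φ : 𝔼 → ℝ} {b K : 𝔼 → 𝔼 → ℝ} {r e Λ : ℝ}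
    (hr : 1 < r) (hu : AEMeasurable u volume) (hφ : AEMeasurable φ volume)
    (hb : AEMeasurable (fun z : 𝔼 × 𝔼 => b z.1 z.2) volume)
    (hK : AEMeasurable (fun z : 𝔼 × 𝔼 => K z.1 z.2) volume) (hb0 : ∀ x y, 0 ≤ b x y)
    (hK0 : ∀ᵐ z : 𝔼 × 𝔼, 0 ≤ K z.1 z.2)
    (hK1 : ∀ᵐ z : 𝔼 × 𝔼, K z.1 z.2 ≤ Λ / ‖z.1 - z.2‖ ^ e)
    (hue : ∫⁻ z in S, ENNReal.ofReal (b z.1 z.2 * (|u z.1 - u z.2| ^ r / ‖z.1 - z.2‖ ^ e)) < ⊤)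
    (hφe : ∫⁻ z in S, ENNReal.ofReal (b z.1 z.2 * (|φ z.1 - φ z.2| ^ r / ‖z.1 - z.2‖ ^ e)) < ⊤) :
    IntegrableOn (fun z : 𝔼 × 𝔼 => b z.1 z.2 * (|u z.1 - u z.2| ^ (r - 2) * (u z.1 - u z.2) *
      (φ z.1 - φ z.2) * K z.1 z.2)) S := by
  have hu1 : AEMeasurable (fun z : 𝔼 × 𝔼 => u z.1) volume := hu.comp_fst
  have hu2 : AEMeasurable (fun z : 𝔼 × 𝔼 => u z.2) volume := hu.comp_snd
  have hφ1 : AEMeasurable (fun z : 𝔼 × 𝔼 => φ z.1) volume := hφ.comp_fst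
  have hφ2 : AEMeasurable (fun z : 𝔼 × 𝔼 => φ z.2) volume := hφ.comp_snd
  have hint : ∀ v : 𝔼 → ℝ, AEMeasurable (fun z : 𝔼 × 𝔼 => v z.1) volume →
      AEMeasurable (fun z : 𝔼 × 𝔼 => v z.2) volume →
      ∫⁻ z in S, ENNReal.ofReal (b z.1 z.2 * (|v z.1 - v z.2| ^ r / ‖z.1 - z.2‖ ^ e)) < ⊤ →
      IntegrableOn (fun z : 𝔼 × 𝔼 => b z.1 z.2 * (|v z.1 - v z.2| ^ r / ‖z.1 - z.2‖ ^ e)) S := by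
    intro v hv1 hv2 hve
    have hvm : AEMeasurable (fun z : 𝔼 × 𝔼 => b z.1 z.2 *
        (|v z.1 - v z.2| ^ r / ‖z.1 - z.2‖ ^ e)) volume :=
      hb.mul (((hv1.sub hv2).norm.pow_const r).div (by fun_prop))
    refine ⟨hvm.restrict.aestronglyMeasurable, ?_⟩
    rw [hasFiniteIntegral_iff_ofReal (ae_of_all _ fun z => ?_)]
    · exact hve
    · have := hb0 z.1 z.2
      show 0 ≤ b z.1 z.2 * (|v z.1 - v z.2| ^ r / ‖z.1 - z.2‖ ^ e)
      positivity
  have hsum := ((hint u hu1 hu2 hue).add (hint φ hφ1 hφ2 hφe)).const_mul Λ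
  refine Integrable.mono' hsum (AEMeasurable.aestronglyMeasurable
    (AEMeasurable.restrict (by fun_prop))) ?_
  refine ae_restrict_of_ae ?_
  filter_upwards [hK0, hK1] with z h0 h1
  have hbz := hb0 z.1 z.2
  have hflux : ‖|u z.1 - u z.2| ^ (r - 2) * (u z.1 - u z.2)‖ = |u z.1 - u z.2| ^ (r - 1) := by
    rw [← abs_rpow_mul_self hr (abs_nonneg (u z.1 - u z.2)), abs_abs, norm_mul, Real.norm_eq_abs,
      Real.norm_eq_abs, abs_of_nonneg (by positivity)]
  rw [norm_mul, norm_mul, norm_mul, hflux, Real.norm_of_nonneg hbz, Real.norm_of_nonneg h0,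
    Real.norm_eq_abs]
  have hY := rpow_sub_one_mul_le hr (abs_nonneg (u z.1 - u z.2)) (abs_nonneg (φ z.1 - φ z.2))
  calc b z.1 z.2 * (|u z.1 - u z.2| ^ (r - 1) * |φ z.1 - φ z.2| * K z.1 z.2)
      ≤ b z.1 z.2 * ((|u z.1 - u z.2| ^ r + |φ z.1 - φ z.2| ^ r) * (Λ / ‖z.1 - z.2‖ ^ e)) := by
        gcongr
    _ = _ := by
        simp only [Pi.add_apply]
        ring

/-- The density of the energy as a sum of the two phases. It holds on the diagonal too, where all
quotients vanish by the convention for division by `0`. -/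
lemma H_div_eq {s t p q : ℝ} {a : 𝔼 → 𝔼 → ℝ} (hsp : 0 < s * p) (htq : 0 < t * q) (x y : 𝔼)
    (τ : ℝ) : H s t p q a x y τ / ‖x - y‖ ^ n =
      τ ^ p / ‖x - y‖ ^ (n + s * p) + a x y * (τ ^ q / ‖x - y‖ ^ (n + t * q)) := by
  have e : ∀ α : ℝ, 0 < α → ‖x - y‖ ^ (n + α) = ‖x - y‖ ^ n * ‖x - y‖ ^ α := fun α hα => by
    rw [Real.rpow_add' (norm_nonneg _) (by positivity), Real.rpow_natCast]
  rw [H, e _ hsp, e _ htq, add_div, div_div, mul_div_assoc, div_div, mul_comm (‖x - y‖ ^ n),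
    mul_comm (‖x - y‖ ^ n)]

lemma energy_lt_top_iff {s t p q : ℝ} {a : 𝔼 → 𝔼 → ℝ} (hsp : 0 < s * p) (htq : 0 < t * q)
    (ha : ∀ x y, 0 ≤ a x y) (S : Set (𝔼 × 𝔼)) {v : 𝔼 → ℝ} (hv : AEMeasurable v volume) :
    ∫⁻ z in S, ENNReal.ofReal (H s t p q a z.1 z.2 |v z.1 - v z.2| / ‖z.1 - z.2‖ ^ n) < ⊤ ↔
    ∫⁻ z in S, ENNReal.ofReal (|v z.1 - v z.2| ^ p / ‖z.1 - z.2‖ ^ (n + s * p)) < ⊤ ∧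
    ∫⁻ z in S, ENNReal.ofReal
      (a z.1 z.2 * (|v z.1 - v z.2| ^ q / ‖z.1 - z.2‖ ^ (n + t * q))) < ⊤ := by
  have h1 : AEMeasurable (fun z : 𝔼 × 𝔼 => v z.1) volume := hv.comp_fst
  have h2 : AEMeasurable (fun z : 𝔼 × 𝔼 => v z.2) volume := hv.comp_snd
  have e : ∀ z : 𝔼 × 𝔼,
      ENNReal.ofReal (H s t p q a z.1 z.2 |v z.1 - v z.2| / ‖z.1 - z.2‖ ^ n) =
      ENNReal.ofReal (|v z.1 - v z.2| ^ p / ‖z.1 - z.2‖ ^ (n + s * p)) + ENNReal.ofReal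
      (a z.1 z.2 * (|v z.1 - v z.2| ^ q / ‖z.1 - z.2‖ ^ (n + t * q))) := fun z => by
    have := ha z.1 z.2
    rw [H_div_eq hsp htq, ENNReal.ofReal_add (by positivity) (by positivity)]
  simp_rw [e]
  rw [lintegral_add_left' (AEMeasurable.restrict (by fun_prop)), ENNReal.add_lt_top]

lemma prod_subset_crossSet {Ω V : Set 𝔼} (hV : V ⊆ Ω) : V ×ˢ V ⊆ crossSet Ω :=
  fun _ hz hz' => hz'.1 (hV hz.1)

lemma abs_truncation_sub_le (a b k : ℝ) : |max (a - k) 0 - max (b - k) 0| ≤ |a - b| := by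
  have := abs_max_sub_max_le_abs (a - k) (b - k) 0
  rwa [sub_sub_sub_cancel_right] at this

lemma truncation_le_abs {a k : ℝ} (hk : 0 ≤ k) : max (a - k) 0 ≤ |a| :=
  max_le ((sub_le_self _ hk).trans (le_abs_self _)) (abs_nonneg _)

/-- The test functions `(u - k)₊ η^m` of the Caccioppoli inequality are admissible as soon as `u`
is `q`-integrable on the support of the cutoff. -/
lemma memA_truncation_mul_cutoff (hn : 0 < n) {s t p q m h ρ M k : ℝ} (hs : 0 < s) (hst : s ≤ t)
    (ht : t < 1) (hp : 1 < p) (hpq : p ≤ q) (hm : 1 ≤ m)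
    {Ω : Set 𝔼} {a : 𝔼 → 𝔼 → ℝ} (ha : IsCoefficient a) {u d η : 𝔼 → ℝ}
    (hu : MemA s t p q a Ω u) (hd : ∀ x y, d x - d y ≤ ‖x - y‖) (hdm : Measurable d)
    (hΩ : {x | d x < ρ + h} ⊆ Ω) (hM : ∀ x, d x < ρ + h → ‖x‖ < M) (hM0 : 0 ≤ M)
    (hη : IsCutoff d η ρ (1 / h)) (hηm : Measurable η) (hk : 0 ≤ k) (hh : 0 < h) (hh1 : h ≤ 1)
    (hup : ∫⁻ x in {x | d x < ρ + h}, ENNReal.ofReal (|u x| ^ p) ≠ ⊤)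
    (huq : ∫⁻ x in {x | d x < ρ + h}, ENNReal.ofReal (|u x| ^ q) ≠ ⊤) :
    MemA s t p q a Ω (fun x => max (u x - k) 0 * η x ^ m) := by
  set V := {x | d x < ρ + h} with hV
  set w : 𝔼 → ℝ := fun x => max (u x - k) 0 with hw
  have hum := hu.measurable
  have hw0 : ∀ x, 0 ≤ w x := fun x => le_max_right _ _
  have hwu : ∀ x, w x ≤ |u x| := fun x => truncation_le_abs hk
  have hwm : AEMeasurable w volume := by fun_prop
  have hsp : 0 < s * p := by positivity
  have hq0 : 0 ≤ q := by linarith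
  have htq : 0 < t * q := mul_pos (by linarith) (by linarith)
  have hψ : IsCutoff d (fun x => η x ^ m) ρ (m / h) := by
    have := hη.rpow hm
    rwa [mul_one_div] at this
  have hφm : AEMeasurable (fun x => w x * η x ^ m) volume := by fun_prop
  have hVm : MeasurableSet V := measurableSet_lt hdm measurable_const
  obtain ⟨B, hB⟩ := ha.bounded
  have hue := (energy_lt_top_iff hsp htq ha.nonneg _ hum).1 hu.energy_lt_top
  refine ⟨hφm, ?_, (energy_lt_top_iff hsp htq ha.nonneg _ hφm).2 ⟨?_, ?_⟩⟩
  · refine hu.memLp.mono hφm.restrict.aestronglyMeasurable (ae_of_all _ fun x => ?_)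
    rw [Real.norm_eq_abs, Real.norm_eq_abs, abs_of_nonneg (mul_nonneg (hw0 x) (hψ.nonneg x))]
    exact (mul_le_of_le_one_right (hw0 x) (hψ.le_one x)).trans (hwu x)
  · obtain ⟨C, hC, h1⟩ := gagliardo_mul_cutoff_le (n := n) (M := M) (α := s * p) (r := p)
      (N := n + p) (B := 1) (m := m) hn hsp (by nlinarith) (by nlinarith)
      (by linarith [(Nat.cast_nonneg n : (0 : ℝ) ≤ n)]) (by linarith) hM0 zero_le_one
    have h2 := h1 d _ w ρ h (fun _ _ => 1) hd hdm hM hψ hw0 hwm hh hh1 (fun _ _ => zero_le_one)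
      (ae_of_all _ fun _ => le_rfl)
    simp only [one_mul] at h2
    refine lt_of_le_of_lt ((setLIntegral_le_lintegral _ _).trans h2) (ENNReal.add_lt_top.2
      ⟨ENNReal.mul_lt_top ENNReal.ofReal_lt_top ?_, ENNReal.mul_lt_top (ENNReal.mul_lt_top
        hC.lt_top ENNReal.ofReal_lt_top) ?_⟩)
    · refine lt_of_le_of_lt ?_ hue.1
      refine (lintegral_mono_set (prod_subset_crossSet hΩ)).trans (lintegral_mono fun z => ?_)
      have := abs_truncation_sub_le (u z.1) (u z.2) k
      dsimp only [w]
      gcongr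
    · refine lt_of_le_of_lt (lintegral_mono fun x => ?_) hup.lt_top
      have := hwu x
      have := hw0 x
      gcongr
  · obtain ⟨C, hC, h1⟩ := gagliardo_mul_cutoff_le (n := n) (M := M) (α := t * q) (r := q)
      (N := n + q) (B := |B|) (m := m) hn htq (by nlinarith) (by nlinarith)
      (by linarith [(Nat.cast_nonneg n : (0 : ℝ) ≤ n)]) (by linarith) hM0 (abs_nonneg B)
    have h2 := h1 d _ w ρ h a hd hdm hM hψ hw0 hwm hh hh1 ha.nonneg
      (hB.mono fun z hz => hz.trans (le_abs_self B))
    refine lt_of_le_of_lt ((setLIntegral_le_lintegral _ _).trans h2) (ENNReal.add_lt_top.2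
      ⟨ENNReal.mul_lt_top ENNReal.ofReal_lt_top ?_, ENNReal.mul_lt_top (ENNReal.mul_lt_top
        hC.lt_top ENNReal.ofReal_lt_top) ?_⟩)
    · refine lt_of_le_of_lt ?_ hue.2
      refine (lintegral_mono_set (prod_subset_crossSet hΩ)).trans (lintegral_mono fun z => ?_)
      have := abs_truncation_sub_le (u z.1) (u z.2) k
      have := ha.nonneg z.1 z.2
      dsimp only [w]
      gcongr
    · refine lt_of_le_of_lt (lintegral_mono fun x => ?_) huq.lt_top
      have := hwu x
      have := hw0 x
      gcongr

/-- Integrability of `F` excludes that its integral vanishes only as a junk value. -/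
lemma lintegral_le_of_le_add_of_integral_eq_zero {X : Type*} [MeasurableSpace X] {μ : Measure X}
    {F G E : X → ℝ} (hF : Integrable F μ) (hF0 : ∫ x, F x ∂μ = 0) (hE : AEMeasurable E μ)
    (hE0 : ∀ x, 0 ≤ E x) (hG0 : ∀ᵐ x ∂μ, 0 ≤ G x) (h : ∀ᵐ x ∂μ, G x ≤ F x + E x) :
    ∫⁻ x, ENNReal.ofReal (G x) ∂μ ≤ ∫⁻ x, ENNReal.ofReal (E x) ∂μ := by
  rcases eq_or_ne (∫⁻ x, ENNReal.ofReal (E x) ∂μ) ⊤ with htop | htop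
  · rw [htop]; exact le_top
  have hEi : Integrable E μ := ⟨hE.aestronglyMeasurable, by
    rw [hasFiniteIntegral_iff_ofReal (ae_of_all _ hE0)]
    exact htop.lt_top⟩
  calc ∫⁻ x, ENNReal.ofReal (G x) ∂μ ≤ ∫⁻ x, ENNReal.ofReal (F x + E x) ∂μ :=
        lintegral_mono_ae (h.mono fun x hx => ENNReal.ofReal_le_ofReal hx)
    _ = ENNReal.ofReal (∫ x, F x + E x ∂μ) := by
        refine (ofReal_integral_eq_lintegral_ofReal (hF.add hEi) ?_).symm
        filter_upwards [h, hG0] with x h1 h2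
        exact h2.trans h1
    _ = ENNReal.ofReal (∫ x, E x ∂μ) := by rw [integral_add hF hEi, hF0, zero_add]
    _ = ∫⁻ x, ENNReal.ofReal (E x) ∂μ :=
        ofReal_integral_eq_lintegral_ofReal hEi (ae_of_all _ hE0)

lemma lintegral_error_le {V : Set 𝔼} (hV : MeasurableSet V) (M r γ : ℝ) {c₁ c₂ : ℝ}
    (hc₁ : 0 ≤ c₁) (hc₂ : 0 ≤ c₂) {w g : 𝔼 → ℝ} (hw : AEMeasurable w volume)
    (hg : AEMeasurable g volume) (hw0 : ∀ x, 0 ≤ w x) (hg0 : ∀ x, 0 ≤ g x) :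
    ∫⁻ z, ENNReal.ofReal (c₁ * nearError V M r γ w z + c₂ * farError V w g z) ≤
      ENNReal.ofReal c₁ * (2 * (∫⁻ y in ball (0 : 𝔼) (2 * M), ENNReal.ofReal (‖y‖ ^ (γ - n))) *
        ∫⁻ x in V, ENNReal.ofReal (w x ^ r)) +
      ENNReal.ofReal c₂ * (2 * (∫⁻ y, ENNReal.ofReal (g y)) * ∫⁻ x in V, ENNReal.ofReal (w x)) := by
  have h1 := aemeasurable_nearError hV M r γ hw
  have e : ∀ z, ENNReal.ofReal (c₁ * nearError V M r γ w z + c₂ * farError V w g z) =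
      ENNReal.ofReal c₁ * ENNReal.ofReal (nearError V M r γ w z) +
        ENNReal.ofReal c₂ * ENNReal.ofReal (farError V w g z) := fun z => by
    have hn0 := nearError_nonneg V M r γ hw0 z
    have hf0 := farError_nonneg V hw0 hg0 z
    rw [ENNReal.ofReal_add (by positivity) (by positivity), ENNReal.ofReal_mul hc₁,
      ENNReal.ofReal_mul hc₂]
  simp_rw [e]
  rw [lintegral_add_left' (by fun_prop), lintegral_const_mul' _ _ ENNReal.ofReal_ne_top,
    lintegral_const_mul' _ _ ENNReal.ofReal_ne_top]
  gcongr
  · exact lintegral_nearError_le hV M r γ hw hw0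
  · exact lintegral_farError_le hV hw hg hw0 hg0

lemma lintegral_tail_lt_top {s p q : ℝ} (hsp : 0 < s * p) (hp : 1 < p) (hpq : p ≤ q)
    {u : 𝔼 → ℝ} (hu : MemTail s p q u) :
    ∫⁻ x, ENNReal.ofReal (|u x| ^ (p - 1) / (1 + ‖x‖) ^ (n + s * p)) < ⊤ := by
  have h1 : ∀ x, ENNReal.ofReal (|u x| ^ (p - 1) / (1 + ‖x‖) ^ (n + s * p)) ≤
      ENNReal.ofReal (1 / (1 + ‖x‖) ^ (n + s * p)) +
        ENNReal.ofReal (|u x| ^ (q - 1) / (1 + ‖x‖) ^ (n + s * p)) := fun x => by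
    rw [← ENNReal.ofReal_add (by positivity) (by positivity), ← add_div]
    gcongr
    rcases le_total |u x| 1 with h | h
    · have := Real.rpow_le_one (abs_nonneg (u x)) h (by linarith : 0 ≤ p - 1)
      have := Real.rpow_nonneg (abs_nonneg (u x)) (q - 1)
      linarith
    · have := Real.rpow_le_rpow_of_exponent_le h (by linarith : p - 1 ≤ q - 1)
      linarith
  refine (lintegral_mono h1).trans_lt ?_
  rw [lintegral_add_left' (by fun_prop), ENNReal.add_lt_top]
  exact ⟨lintegral_one_div_one_add_norm_lt_top (by linarith), hu.lt_top⟩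

/-- The Caccioppoli inequality for the truncations `(u - k)₊` of a weak solution. The constant does
not depend on the level `k ≥ 0`, and depends on the gap `h` through a power only. -/
theorem caccioppoli (hn : 0 < n) {s t p q Λ M : ℝ} (hs : 0 < s) (hst : s ≤ t) (ht : t < 1)
    (hp : 1 < p) (hpq : p ≤ q) (hΛ : 1 < Λ) (hM0 : 0 ≤ M) {Ω : Set 𝔼} {Ksp Ktq a : 𝔼 → 𝔼 → ℝ}
    (hKsp : IsKernel s p Λ Ksp) (hKtq : IsKernel t q Λ Ktq) (ha : IsCoefficient a) {u : 𝔼 → ℝ}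
    (hu : IsWeakSolution s t p q Ksp Ktq a Ω u) (hu_tail : MemTail s p q u) :
    ∃ C : ℝ≥0∞, C ≠ ⊤ ∧ ∀ (d : 𝔼 → ℝ) (ρ h k : ℝ), (∀ x y, d x - d y ≤ ‖x - y‖) →
      Measurable d → {x | d x < ρ + 2 * h} ⊆ Ω → (∀ x, d x < ρ + 2 * h → ‖x‖ < M) →
      0 ≤ k → 0 < h → h ≤ 1 →
      ∫⁻ x in {x | d x < ρ + 2 * h}, ENNReal.ofReal (|u x| ^ p) ≠ ⊤ →
      ∫⁻ x in {x | d x < ρ + 2 * h}, ENNReal.ofReal (|u x| ^ q) ≠ ⊤ →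
      ∫⁻ z in {x | d x < ρ} ×ˢ {x | d x < ρ}, ENNReal.ofReal
        (|max (u z.1 - k) 0 - max (u z.2 - k) 0| ^ p / ‖z.1 - z.2‖ ^ (n + s * p)) ≤
      C * ENNReal.ofReal (h⁻¹ ^ (n + q)) *
        ((∫⁻ x in {x | d x < ρ + 2 * h}, ENNReal.ofReal (max (u x - k) 0 ^ p)) +
        (∫⁻ x in {x | d x < ρ + 2 * h}, ENNReal.ofReal (max (u x - k) 0 ^ q)) +
        ∫⁻ x in {x | d x < ρ + 2 * h}, ENNReal.ofReal (max (u x - k) 0)) := by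
  obtain ⟨B₀, hB₀⟩ := ha.bounded
  set B := |B₀| with hBdef
  have hB0 : 0 ≤ B := abs_nonneg _
  have hB : ∀ᵐ z : 𝔼 × 𝔼, a z.1 z.2 ≤ B := hB₀.mono fun z hz => hz.trans (le_abs_self _)
  have hn0 : (0 : ℝ) ≤ n := Nat.cast_nonneg n
  have hsp : 0 < s * p := by positivity
  have htq : 0 < t * q := mul_pos (by linarith) (by linarith)
  have hsp_le : s * p ≤ t * q := mul_le_mul hst hpq (by linarith) (by linarith)
  have hsp_lt : s * p < p := by nlinarith
  have htq_lt : t * q < q := by nlinarith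
  have hΛ0 : 0 < Λ := by linarith
  set N : ℝ := n + q with hN
  set gp : 𝔼 → ℝ := fun y => |u y| ^ (p - 1) / (1 + ‖y‖) ^ (n + s * p) with hgp
  set gq : 𝔼 → ℝ := fun y => |u y| ^ (q - 1) / (1 + ‖y‖) ^ (n + s * p) with hgq
  set Tp := ∫⁻ y, ENNReal.ofReal (gp y) with hTp
  set Tq := ∫⁻ y, ENNReal.ofReal (gq y) with hTq
  have hTp_top : Tp ≠ ⊤ := (lintegral_tail_lt_top hsp hp hpq hu_tail).ne
  have hTq_top : Tq ≠ ⊤ := hu_tail.lt_top.ne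
  set Ap := ∫⁻ y in ball (0 : 𝔼) (2 * M), ENNReal.ofReal (‖y‖ ^ (p - s * p - n)) with hAp
  set Aq := ∫⁻ y in ball (0 : 𝔼) (2 * M), ENNReal.ofReal (‖y‖ ^ (q - t * q - n)) with hAq
  have hAp_top : Ap ≠ ⊤ := (lintegral_ball_norm_rpow_lt_top hn (by linarith) _).ne
  have hAq_top : Aq ≠ ⊤ := (lintegral_ball_norm_rpow_lt_top hn (by linarith) _).ne
  set D : ℝ≥0∞ := ENNReal.ofReal (1 * Λ * q ^ p) * (2 * Ap) +
    ENNReal.ofReal (1 * Λ * (2 + M) ^ N) * (2 * Tp) +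
    (ENNReal.ofReal (B * Λ * q ^ q) * (2 * Aq) +
      ENNReal.ofReal (B * Λ * (2 + M) ^ N) * (2 * Tq)) with hD
  have hD_top : D ≠ ⊤ := by
    have hmul : ∀ (c : ℝ) (A : ℝ≥0∞), A ≠ ⊤ → ENNReal.ofReal c * (2 * A) ≠ ⊤ := fun c A hA =>
      ENNReal.mul_ne_top ENNReal.ofReal_ne_top (ENNReal.mul_ne_top (by simp) hA)
    exact ENNReal.add_ne_top.2 ⟨ENNReal.add_ne_top.2 ⟨hmul _ _ hAp_top, hmul _ _ hTp_top⟩,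
      ENNReal.add_ne_top.2 ⟨hmul _ _ hAq_top, hmul _ _ hTq_top⟩⟩
  refine ⟨ENNReal.ofReal Λ * D, ENNReal.mul_ne_top ENNReal.ofReal_ne_top hD_top, ?_⟩
  intro d ρ h k hd hdm hΩ hM hk hh hh1 hup huq
  set V := {x | d x < ρ + 2 * h} with hV
  have hV' : {x | d x < ρ + h + h} = V := by
    rw [hV]; congr 1; ext x; rw [add_assoc, two_mul]
  have hVm : MeasurableSet V := measurableSet_lt hdm measurable_const
  set U := {x | d x < ρ} with hU
  have hUm : MeasurableSet U := measurableSet_lt hdm measurable_const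
  have hUΩ : U ⊆ Ω := fun x hx => hΩ (by
    simp only [hU, hV, mem_ofPred_eq] at hx ⊢; linarith)
  have hη := isCutoff_cutoff hd ρ hh
  set η := cutoff d ρ h with hηd
  have hηm : Measurable η := by
    rw [hηd]; unfold cutoff; fun_prop
  have hη1 : ∀ x ∈ U, η x = 1 := fun x hx => cutoff_eq_one hh (le_of_lt hx)
  have hum := hu.memA.measurable
  set w : 𝔼 → ℝ := fun x => max (u x - k) 0 with hw
  have hw0 : ∀ x, 0 ≤ w x := fun x => le_max_right _ _
  have hwm : AEMeasurable w volume := by fun_prop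
  set φ : 𝔼 → ℝ := fun x => w x * η x ^ q with hφ
  have hφA : MemA s t p q a Ω φ := by
    rw [← hV'] at hΩ hup huq
    exact memA_truncation_mul_cutoff hn hs hst ht hp hpq (by linarith) ha hu.memA hd hdm hΩ
      (fun x hx => hM x (by linarith)) hM0 hη hηm hk hh hh1 hup huq
  have hφ0 : ∀ᵐ x, x ∉ Ω → φ x = 0 := ae_of_all _ fun x hx => by
    have hx' : ρ + h ≤ d x := by
      by_contra! hcon
      exact hx (hΩ (show d x < ρ + 2 * h by linarith))
    rw [hφ]
    simp only
    rw [hη.eq_zero x hx', Real.zero_rpow (by linarith), mul_zero]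
  have hKsp0 : ∀ᵐ z : 𝔼 × 𝔼, 0 ≤ Ksp z.1 z.2 := hKsp.lower.mono fun z hz =>
    le_trans (by positivity) hz
  have hKtq0 : ∀ᵐ z : 𝔼 × 𝔼, 0 ≤ Ktq z.1 z.2 := hKtq.lower.mono fun z hz =>
    le_trans (by positivity) hz
  have hue := (energy_lt_top_iff hsp htq ha.nonneg _ hum).1 hu.memA.energy_lt_top
  have hφe := (energy_lt_top_iff hsp htq ha.nonneg _ hφA.measurable).1 hφA.energy_lt_top
  have hF1 : IntegrableOn (fun z : 𝔼 × 𝔼 => |u z.1 - u z.2| ^ (p - 2) * (u z.1 - u z.2) *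
      (φ z.1 - φ z.2) * Ksp z.1 z.2) (crossSet Ω) := by
    have := integrableOn_phase (b := fun _ _ => 1) hp hum hφA.measurable (by fun_prop)
      hKsp.measurable (fun _ _ => zero_le_one) hKsp0 hKsp.upper (by simpa using hue.1)
      (by simpa using hφe.1)
    simpa using this
  have hF2 := integrableOn_phase (by linarith) hum hφA.measurable ha.measurable hKtq.measurable
    ha.nonneg hKtq0 hKtq.upper hue.2 hφe.2
  have hF : IntegrableOn (fun z : 𝔼 × 𝔼 => weakIntegrand p q Ksp Ktq a u φ z.1 z.2)
    (crossSet Ω) := hF1.add hF2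
  -- the error terms of the two phases
  set c₁ : ℝ := 1 * Λ * q ^ p * (1 / h) ^ p with hc₁
  set c₂ : ℝ := 1 * Λ * ((2 + M) / h) ^ N with hc₂
  set c₃ : ℝ := B * Λ * q ^ q * (1 / h) ^ q with hc₃
  set c₄ : ℝ := B * Λ * ((2 + M) / h) ^ N with hc₄
  have hq0 : 0 < q := by linarith
  have hc₁0 : 0 ≤ c₁ := by positivity
  have hc₂0 : 0 ≤ c₂ := by positivity
  have hc₃0 : 0 ≤ c₃ := by positivity
  have hc₄0 : 0 ≤ c₄ := by positivity
  have hgp0 : ∀ y, 0 ≤ gp y := fun y => by positivity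
  have hgq0 : ∀ y, 0 ≤ gq y := fun y => by positivity
  have hgpm : AEMeasurable gp volume := by fun_prop
  have hgqm : AEMeasurable gq volume := by fun_prop
  set Ep : 𝔼 × 𝔼 → ℝ := fun z => c₁ * nearError V M p (p - s * p) w z + c₂ * farError V w gp z
    with hEp
  set Eq : 𝔼 × 𝔼 → ℝ := fun z => c₃ * nearError V M q (q - t * q) w z + c₄ * farError V w gq z
    with hEq
  have hEp0 : ∀ z, 0 ≤ Ep z := fun z => add_nonneg
    (mul_nonneg hc₁0 (nearError_nonneg V M _ _ hw0 z)) (mul_nonneg hc₂0 (farError_nonneg V hw0 hgp0 z))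
  have hEq0 : ∀ z, 0 ≤ Eq z := fun z => add_nonneg
    (mul_nonneg hc₃0 (nearError_nonneg V M _ _ hw0 z)) (mul_nonneg hc₄0 (farError_nonneg V hw0 hgq0 z))
  have hEpm : AEMeasurable Ep volume :=
    ((aemeasurable_nearError hVm M p _ hwm).const_mul c₁).add
      ((aemeasurable_farError hVm hwm hgpm).const_mul c₂)
  have hEqm : AEMeasurable Eq volume :=
    ((aemeasurable_nearError hVm M q _ hwm).const_mul c₃).add
      ((aemeasurable_farError hVm hwm hgqm).const_mul c₄)
  set G : 𝔼 × 𝔼 → ℝ := (U ×ˢ U).indicator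
    (fun z => |w z.1 - w z.2| ^ p * Ksp z.1 z.2) with hG
  have hM' : ∀ x, d x < ρ + h + h → ‖x‖ < M := fun x hx => hM x (by linarith)
  have hGF : ∀ᵐ z : 𝔼 × 𝔼, G z ≤ weakIntegrand p q Ksp Ktq a u φ z.1 z.2 + (Ep z + Eq z) := by
    filter_upwards [hKsp0, hKsp.upper, hKtq0, hKtq.upper, hB] with z hs0 hs1 ht0 ht1 hzB
    have e1 := indicator_le_phase_add_error (u := u) (B := 1) (N := N) (b := 1) (k := k) (m := q)
      (r := p) hd hM' hη (by positivity) hη1 hh hh1 hp hpq hsp.le le_rfl (by linarith)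
      zero_le_one le_rfl hΛ0.le hk z.1 z.2 hs0 hs1
    have e2 := indicator_le_phase_add_error (u := u) (N := N) (k := k) (m := q)
      (r := q) hd hM' hη (by positivity) hη1 hh hh1 (by linarith) le_rfl hsp.le hsp_le (by linarith)
      (ha.nonneg z.1 z.2) hzB hΛ0.le hk z.1 z.2 ht0 ht1
    rw [hV'] at e1 e2
    have e3 : 0 ≤ (U ×ˢ U).indicator (fun z' : 𝔼 × 𝔼 => a z.1 z.2 *
        (|max (u z'.1 - k) 0 - max (u z'.2 - k) 0| ^ q * Ktq z.1 z.2)) (z.1, z.2) := by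
      refine indicator_nonneg (fun z' _ => ?_) _
      have := ha.nonneg z.1 z.2
      positivity
    have e4 : G z = (U ×ˢ U).indicator (fun z' : 𝔼 × 𝔼 => 1 *
        (|max (u z'.1 - k) 0 - max (u z'.2 - k) 0| ^ p * Ksp z.1 z.2)) (z.1, z.2) := by
      rw [hG]
      by_cases hz : z ∈ U ×ˢ U
      · rw [indicator_of_mem hz, indicator_of_mem (show (z.1, z.2) ∈ U ×ˢ U from hz), one_mul]
      · rw [indicator_of_notMem hz, indicator_of_notMem (show (z.1, z.2) ∉ U ×ˢ U from hz)]
    rw [e4]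
    -- the positive contribution of the `q`-phase is not needed
    have e5 := e3.trans e2
    simp only [weakIntegrand]
    rw [one_mul (|u z.1 - u z.2| ^ (p - 2) * _ * _ * _)] at e1
    linarith
  have hG0 : ∀ᵐ z : 𝔼 × 𝔼, 0 ≤ G z := hKsp0.mono fun z hz => by
    rw [hG]
    by_cases hzU : z ∈ U ×ˢ U
    · rw [indicator_of_mem hzU]; positivity
    · rw [indicator_of_notMem hzU]
  have hmain := lintegral_le_of_le_add_of_integral_eq_zero hF (hu.weak_eq φ hφA hφ0)
    (hEpm.add hEqm).restrict (fun z => add_nonneg (hEp0 z) (hEq0 z)) (ae_restrict_of_ae hG0)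
    (ae_restrict_of_ae hGF)
  set P := ∫⁻ x in V, ENNReal.ofReal (w x ^ p) with hP
  set Q := ∫⁻ x in V, ENNReal.ofReal (w x ^ q) with hQ
  set I := ∫⁻ x in V, ENNReal.ofReal (w x) with hI
  have hinv : 1 ≤ h⁻¹ := (one_le_inv₀ hh).2 hh1
  have hpow : ∀ r, r ≤ N → (1 / h) ^ r ≤ h⁻¹ ^ N := fun r hr => by
    rw [one_div]; exact Real.rpow_le_rpow_of_exponent_le hinv hr
  have hfar : ((2 + M) / h) ^ N = (2 + M) ^ N * h⁻¹ ^ N := by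
    rw [div_eq_mul_inv, Real.mul_rpow (by positivity) (by positivity)]
  set X := ENNReal.ofReal (h⁻¹ ^ N) with hX
  have b₁ : ENNReal.ofReal c₁ ≤ ENNReal.ofReal (1 * Λ * q ^ p) * X := by
    rw [hX, ← ENNReal.ofReal_mul (by positivity), hc₁]
    gcongr
    exact hpow p (by linarith)
  have b₂ : ENNReal.ofReal c₂ = ENNReal.ofReal (1 * Λ * (2 + M) ^ N) * X := by
    rw [hX, ← ENNReal.ofReal_mul (by positivity), hc₂, hfar, mul_assoc (1 * Λ)]
  have b₃ : ENNReal.ofReal c₃ ≤ ENNReal.ofReal (B * Λ * q ^ q) * X := by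
    rw [hX, ← ENNReal.ofReal_mul (by positivity), hc₃]
    gcongr
    exact hpow q (by linarith)
  have b₄ : ENNReal.ofReal c₄ = ENNReal.ofReal (B * Λ * (2 + M) ^ N) * X := by
    rw [hX, ← ENNReal.ofReal_mul (by positivity), hc₄, hfar, mul_assoc (B * Λ)]
  have hE : ∫⁻ z in crossSet Ω, ENNReal.ofReal (Ep z + Eq z) ≤ X * D * (P + Q + I) := by
    calc ∫⁻ z in crossSet Ω, ENNReal.ofReal (Ep z + Eq z)
        ≤ ∫⁻ z, ENNReal.ofReal (Ep z + Eq z) := setLIntegral_le_lintegral _ _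
      _ = (∫⁻ z, ENNReal.ofReal (Ep z)) + ∫⁻ z, ENNReal.ofReal (Eq z) := by
          rw [← lintegral_add_left' hEpm.ennreal_ofReal]
          exact lintegral_congr fun z => ENNReal.ofReal_add (hEp0 z) (hEq0 z)
      _ ≤ (ENNReal.ofReal c₁ * (2 * Ap * P) + ENNReal.ofReal c₂ * (2 * Tp * I)) +
          (ENNReal.ofReal c₃ * (2 * Aq * Q) + ENNReal.ofReal c₄ * (2 * Tq * I)) :=
          add_le_add (lintegral_error_le hVm M p _ hc₁0 hc₂0 hwm hgpm hw0 hgp0)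
            (lintegral_error_le hVm M q _ hc₃0 hc₄0 hwm hgqm hw0 hgq0)
      _ ≤ (ENNReal.ofReal (1 * Λ * q ^ p) * X * (2 * Ap * (P + Q + I)) +
            ENNReal.ofReal (1 * Λ * (2 + M) ^ N) * X * (2 * Tp * (P + Q + I))) +
          (ENNReal.ofReal (B * Λ * q ^ q) * X * (2 * Aq * (P + Q + I)) +
            ENNReal.ofReal (B * Λ * (2 + M) ^ N) * X * (2 * Tq * (P + Q + I))) := by
          rw [b₂, b₄]
          have hPle : P ≤ P + Q + I := le_self_add.trans le_self_add
          have hQle : Q ≤ P + Q + I := le_add_self.trans le_self_add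
          have hIle : I ≤ P + Q + I := le_add_self
          gcongr
      _ = X * D * (P + Q + I) := by rw [hD]; ring
  have hUU : MeasurableSet (U ×ˢ U) := hUm.prod hUm
  have hlow : ∫⁻ z in U ×ˢ U, ENNReal.ofReal (|w z.1 - w z.2| ^ p / ‖z.1 - z.2‖ ^ (n + s * p)) ≤
      ENNReal.ofReal Λ * ∫⁻ z in crossSet Ω, ENNReal.ofReal (G z) := by
    calc _ ≤ ∫⁻ z in U ×ˢ U, ENNReal.ofReal Λ * ENNReal.ofReal (G z) := by
          refine lintegral_mono_ae ?_
          filter_upwards [ae_restrict_of_ae hKsp.lower, ae_restrict_mem hUU] with z hz hzU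
          rw [← ENNReal.ofReal_mul hΛ0.le, hG, indicator_of_mem hzU]
          refine ENNReal.ofReal_le_ofReal ?_
          calc |w z.1 - w z.2| ^ p / ‖z.1 - z.2‖ ^ (n + s * p)
              = Λ * (|w z.1 - w z.2| ^ p * (Λ⁻¹ / ‖z.1 - z.2‖ ^ (n + s * p))) := by
                field_simp
            _ ≤ _ := by gcongr
      _ = ENNReal.ofReal Λ * ∫⁻ z in U ×ˢ U, ENNReal.ofReal (G z) :=
          lintegral_const_mul' _ _ ENNReal.ofReal_ne_top
      _ ≤ _ := by
          gcongr
          exact prod_subset_crossSet hUΩ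
  calc _ ≤ _ := hlow
    _ ≤ ENNReal.ofReal Λ * (X * D * (P + Q + I)) := by
        gcongr
        exact hmain.trans hE
    _ = _ := by ring

/-! ### De Giorgi iteration -/

/-- Powers of a truncation are controlled by the top power of a truncation at a lower level. -/
lemma truncation_rpow_le {a k l ε e κ : ℝ} (hε : 0 < ε) (hε1 : ε ≤ 1) (hkl : l + ε ≤ k)
    (he : 0 < e) (heκ : e ≤ κ) :
    max (a - k) 0 ^ e ≤ ε⁻¹ ^ κ * max (a - l) 0 ^ κ := by
  rcases le_or_gt a k with h | h
  · rw [max_eq_right (by linarith), Real.zero_rpow he.ne']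
    have : 0 ≤ max (a - l) 0 := le_max_right _ _
    positivity
  · rw [max_eq_left (by linarith), max_eq_left (by linarith)]
    have h1 : ε ≤ a - l := by linarith
    have h0 : 0 < a - l := by linarith
    have h2 : 1 ≤ ε⁻¹ * (a - l) := by
      rw [inv_mul_eq_div, le_div_iff₀ hε]; linarith
    have h3 : a - l ≤ ε⁻¹ * (a - l) :=
      le_mul_of_one_le_left h0.le ((one_le_inv₀ hε).2 hε1)
    calc (a - k) ^ e ≤ (ε⁻¹ * (a - l)) ^ e :=
          Real.rpow_le_rpow (by linarith) (by linarith) he.le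
      _ ≤ (ε⁻¹ * (a - l)) ^ κ := Real.rpow_le_rpow_of_exponent_le h2 heκ
      _ = _ := Real.mul_rpow (by positivity) h0.le

/-- Fast geometric convergence: a superlinear recursion with geometrically growing constants tends
to `0` if it starts small enough. -/
lemma exists_tendsto_zero_of_le_rpow {A : ℝ≥0∞} (hA : A ≠ ⊤) {b γ : ℝ} (hb : 1 < b) (hγ : 1 < γ) :
    ∃ μ : ℝ, 0 < μ ∧ ∀ Y : ℕ → ℝ≥0∞, Y 0 ≤ ENNReal.ofReal μ →
      (∀ j, Y (j + 1) ≤ (A * ENNReal.ofReal (b ^ j) * Y j) ^ γ) → Tendsto Y atTop (𝓝 0) := by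
  have hγ1 : 0 < γ - 1 := by linarith
  have hb0 : 0 < b := by linarith
  set A' : ℝ := A.toReal + 1 with hA'
  have hA'0 : 0 < A' := by positivity
  have hAA' : A ≤ ENNReal.ofReal A' := by
    rw [ENNReal.le_ofReal_iff_toReal_le hA hA'0.le]; linarith
  -- `θ` and `μ` solve `(b θ)^γ = θ` and `(A' μ)^γ = μ θ`
  set θ : ℝ := b ^ (-(γ / (γ - 1))) with hθ
  have hθ0 : 0 < θ := by positivity
  have hθ1 : θ < 1 := Real.rpow_lt_one_of_one_lt_of_neg hb (by
    have : 0 < γ / (γ - 1) := by positivity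
    linarith)
  have hθe : (b * θ) ^ γ = θ := by
    have : b * θ = b ^ (1 + -(γ / (γ - 1))) := by
      rw [Real.rpow_add hb0, Real.rpow_one]
    rw [this, ← Real.rpow_mul hb0.le, hθ]
    congr 1
    field_simp
    ring
  set μ : ℝ := (θ / A' ^ γ) ^ (1 / (γ - 1)) with hμ
  have hμ0 : 0 < μ := by positivity
  have hμe : (A' * μ) ^ γ = μ * θ := by
    have h1 : μ ^ (γ - 1) = θ / A' ^ γ := by
      rw [hμ, ← Real.rpow_mul (by positivity), one_div_mul_cancel hγ1.ne', Real.rpow_one]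
    have h2 : μ ^ γ = μ ^ (γ - 1) * μ := by
      rw [← Real.rpow_add_one hμ0.ne', sub_add_cancel]
    rw [Real.mul_rpow hA'0.le hμ0.le, h2, h1]
    field_simp
  refine ⟨μ, hμ0, fun Y h0 hY => ?_⟩
  have key : ∀ j, Y j ≤ ENNReal.ofReal (μ * θ ^ j) := by
    intro j
    induction j with
    | zero => simpa using h0
    | succ j ih =>
      calc Y (j + 1) ≤ (A * ENNReal.ofReal (b ^ j) * Y j) ^ γ := hY j
        _ ≤ (ENNReal.ofReal A' * ENNReal.ofReal (b ^ j) * ENNReal.ofReal (μ * θ ^ j)) ^ γ := by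
          gcongr
        _ = ENNReal.ofReal ((A' * b ^ j * (μ * θ ^ j)) ^ γ) := by
          rw [← ENNReal.ofReal_mul (by positivity), ← ENNReal.ofReal_mul (by positivity),
            ENNReal.ofReal_rpow_of_nonneg (by positivity) (by linarith)]
        _ = ENNReal.ofReal (μ * θ ^ (j + 1)) := by
          congr 1
          have : A' * b ^ j * (μ * θ ^ j) = (A' * μ) * (b * θ) ^ j := by ring
          rw [this, Real.mul_rpow (by positivity) (by positivity), hμe, ← Real.rpow_natCast,
            ← Real.rpow_mul (by positivity), mul_comm (j : ℝ), Real.rpow_mul (by positivity), hθe,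
            Real.rpow_natCast]
          ring
  have hlim : Tendsto (fun j : ℕ => ENNReal.ofReal (μ * θ ^ j)) atTop (𝓝 0) := by
    have := (tendsto_pow_atTop_nhds_zero_of_lt_one hθ0.le hθ1).const_mul μ
    rw [mul_zero] at this
    simpa using ENNReal.tendsto_ofReal this
  exact tendsto_of_tendsto_of_tendsto_of_le_of_le tendsto_const_nhds hlim (fun _ => zero_le) key

/-- An exponent `κ ≥ q` into which the fractional Sobolev space of order `s` and exponent `p` embeds
locally: the critical one if `s p < n`, any exponent above `q` otherwise. -/
lemma exists_sobolev_exponent (hn : 0 < n) {s p q : ℝ} (hs : 0 < s) (hp : 1 < p) (hpq : p ≤ q)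
    (hq : s * p < n → q ≤ n * p / (n - s * p)) :
    ∃ κ : ℝ, q ≤ κ ∧ p < κ ∧ n * (1 - p / κ) ≤ s * p := by
  have hn0 : (0 : ℝ) < n := by exact_mod_cast hn
  rcases lt_or_ge (s * p) n with h | h
  · have hpos : 0 < n - s * p := by linarith
    have hsp : 0 < s * p := by positivity
    refine ⟨n * p / (n - s * p), hq h, ?_, le_of_eq ?_⟩
    · rw [lt_div_iff₀ hpos]
      nlinarith
    · field_simp
      ring
  · refine ⟨q + 1, by linarith, by linarith, le_trans ?_ h⟩
    have : 0 ≤ p / (q + 1) := div_nonneg (by linarith) (by linarith)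
    nlinarith

/-- One step of the De Giorgi iteration: a superlinear estimate for the `κ`-th power of the
truncation at the level `k` by that at a lower level `l` on a larger set. -/
lemma truncation_energy_step (hn : 0 < n) {s t p q κ Λ M : ℝ} (hs : 0 < s) (hst : s ≤ t)
    (ht : t < 1) (hp : 1 < p) (hpq : p ≤ q) (hqκ : q ≤ κ) (hpκ : p < κ)
    (hκ : n * (1 - p / κ) ≤ s * p) (hΛ : 1 < Λ) (hM0 : 0 < M) {Ω : Set 𝔼}
    {Ksp Ktq a : 𝔼 → 𝔼 → ℝ} (hKsp : IsKernel s p Λ Ksp) (hKtq : IsKernel t q Λ Ktq)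
    (ha : IsCoefficient a) {u : 𝔼 → ℝ}
    (hu : IsWeakSolution s t p q Ksp Ktq a Ω u) (hu_tail : MemTail s p q u) :
    ∃ C : ℝ≥0∞, C ≠ ⊤ ∧ ∀ (d : 𝔼 → ℝ) (ρ h k l ε : ℝ), (∀ x y, d x - d y ≤ ‖x - y‖) →
      Measurable d → {x | d x < ρ + 4 * h} ⊆ Ω → (∀ x, d x < ρ + 4 * h → ‖x‖ < M) →
      0 ≤ k → 0 < h → h ≤ 1 → 0 < ε → ε ≤ 1 → l + ε ≤ k →
      ∫⁻ x in {x | d x < ρ + 4 * h}, ENNReal.ofReal (|u x| ^ p) ≠ ⊤ →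
      ∫⁻ x in {x | d x < ρ + 4 * h}, ENNReal.ofReal (|u x| ^ q) ≠ ⊤ →
      ∫⁻ x in {x | d x < ρ}, ENNReal.ofReal (max (u x - k) 0 ^ κ) ≤
      (C * ENNReal.ofReal (h⁻¹ ^ (n + q) * ε⁻¹ ^ κ) *
        ∫⁻ x in {x | d x < ρ + 4 * h}, ENNReal.ofReal (max (u x - l) 0 ^ κ)) ^ (κ / p) := by
  have hn0 : (0 : ℝ) ≤ n := Nat.cast_nonneg n
  have hsp_lt : s * p < p := by nlinarith
  obtain ⟨C₁, hC₁, h1⟩ := local_fractional_sobolev (n := n) (M := M) (N := n + q) hn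
    (by linarith : 0 < p) hpκ hκ hsp_lt (by linarith) (by linarith) hM0
  obtain ⟨C₂, hC₂, h2⟩ := caccioppoli hn hs hst ht hp hpq hΛ hM0.le hKsp hKtq ha hu hu_tail
  refine ⟨C₁ * (3 * C₂ + 1), ENNReal.mul_ne_top hC₁ (ENNReal.add_ne_top.2
    ⟨ENNReal.mul_ne_top (by simp) hC₂, by simp⟩), ?_⟩
  intro d ρ h k l ε hd hdm hΩ hM hk hh hh1 hε hε1 hkl hup huq
  set V := {x | d x < ρ + 4 * h} with hV
  set V₂ := {x | d x < ρ + 2 * h} with hV₂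
  have hV₂V : V₂ ⊆ V := fun x hx => by
    simp only [hV, hV₂, mem_ofPred_eq] at hx ⊢; linarith
  have hV' : {x | d x < ρ + 2 * h + 2 * h} = V := by
    rw [hV]; congr 1; ext x; rw [add_assoc, ← add_mul]; norm_num
  have hum := hu.memA.measurable
  have e1 := h1 d (fun x => max (u x - k) 0) ρ h hd hdm (fun x hx => hM x (hV₂V hx))
    (fun x => le_max_right _ _) (by fun_prop) hh hh1
  have e2 := h2 d (ρ + 2 * h) h k hd hdm (by rwa [hV']) (fun x hx => hM x (by linarith)) hk hh hh1
    (by rwa [hV']) (by rwa [hV'])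
  rw [hV'] at e2
  set X := ENNReal.ofReal (h⁻¹ ^ (n + q)) with hX
  set Z := ∫⁻ x in V, ENNReal.ofReal (max (u x - l) 0 ^ κ) with hZ
  set e := ENNReal.ofReal (ε⁻¹ ^ κ) with he
  have hle : ∀ r, 0 < r → r ≤ κ →
      ∫⁻ x in V, ENNReal.ofReal (max (u x - k) 0 ^ r) ≤ e * Z := fun r hr hrκ => by
    rw [hZ, he, ← lintegral_const_mul' _ _ ENNReal.ofReal_ne_top]
    refine lintegral_mono fun x => ?_
    rw [← ENNReal.ofReal_mul (by positivity)]
    exact ENNReal.ofReal_le_ofReal (truncation_rpow_le hε hε1 hkl hr hrκ)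
  have hle1 := hle 1 one_pos (by linarith)
  simp only [Real.rpow_one] at hle1
  refine e1.trans (ENNReal.rpow_le_rpow ?_ (div_nonneg (by linarith) (by linarith)))
  calc C₁ * (_ + X * ∫⁻ x in V₂, ENNReal.ofReal (max (u x - k) 0 ^ p))
      ≤ C₁ * (C₂ * X * (e * Z + e * Z + e * Z) + X * (e * Z)) := by
        gcongr C₁ * (?_ + X * ?_)
        · refine e2.trans ?_
          gcongr
          · exact hle p (by linarith) hpκ.le
          · exact hle q (by linarith) hqκ
        · exact (lintegral_mono_set hV₂V).trans (hle p (by linarith) hpκ.le)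
    _ = C₁ * (3 * C₂ + 1) * (X * e) * Z := by ring
    _ = _ := by rw [hX, he, ← ENNReal.ofReal_mul (by positivity)]

lemma lintegral_rpow_ne_top_of_le {V : Set 𝔼} (hV : volume V ≠ ⊤) {u : 𝔼 → ℝ} {q κ : ℝ}
    (hq : 0 ≤ q) (hqκ : q ≤ κ) (h : ∫⁻ x in V, ENNReal.ofReal (|u x| ^ κ) ≠ ⊤) :
    ∫⁻ x in V, ENNReal.ofReal (|u x| ^ q) ≠ ⊤ := by
  refine ne_top_of_le_ne_top (b := (∫⁻ x in V, 1) + ∫⁻ x in V, ENNReal.ofReal (|u x| ^ κ)) ?_ ?_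
  · simpa using ⟨hV, h⟩
  · rw [← lintegral_add_left measurable_const]
    refine lintegral_mono fun x => ?_
    rw [← ENNReal.ofReal_one, ← ENNReal.ofReal_add zero_le_one (by positivity)]
    gcongr
    rcases le_total |u x| 1 with h | h
    · linarith [Real.rpow_le_one (abs_nonneg (u x)) h hq, Real.rpow_nonneg (abs_nonneg (u x)) κ]
    · linarith [Real.rpow_le_rpow_of_exponent_le h hqκ]

lemma tendsto_lintegral_truncation {V : Set 𝔼} {u : 𝔼 → ℝ} (hum : AEMeasurable u volume) {κ : ℝ}
    (hκ : 0 < κ) (h : ∫⁻ x in V, ENNReal.ofReal (|u x| ^ κ) ≠ ⊤) :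
    Tendsto (fun K : ℕ => ∫⁻ x in V, ENNReal.ofReal (max (u x - K) 0 ^ κ)) atTop (𝓝 0) := by
  have hlim := tendsto_lintegral_of_dominated_convergence' (μ := volume.restrict V)
    (F := fun (K : ℕ) x => ENNReal.ofReal (max (u x - K) 0 ^ κ)) (f := fun _ => 0)
    (fun x => ENNReal.ofReal (|u x| ^ κ)) (fun K => AEMeasurable.restrict (by fun_prop))
    (fun K => ae_of_all _ fun x => ?_) h (ae_of_all _ fun x => ?_)
  · simpa using hlim
  · exact ENNReal.ofReal_le_ofReal (Real.rpow_le_rpow (le_max_right _ _)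
      (truncation_le_abs (Nat.cast_nonneg K)) hκ.le)
  · refine tendsto_const_nhds.congr' ?_
    filter_upwards [eventually_ge_atTop ⌈u x⌉₊] with K hK
    have : u x ≤ K := (Nat.le_ceil _).trans (by exact_mod_cast hK)
    rw [max_eq_right (by linarith), Real.zero_rpow hκ.ne', ENNReal.ofReal_zero]

/-- A weak solution is locally bounded above. -/
theorem exists_ae_le_of_isWeakSolution (hn : 0 < n) {s t p q Λ : ℝ} (hs : 0 < s) (hst : s ≤ t)
    (ht : t < 1) (hp : 1 < p) (hpq : p ≤ q) (hΛ : 1 < Λ) {Ω : Set 𝔼} (hΩo : IsOpen Ω)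
    (hΩb : Bornology.IsBounded Ω) {Ksp Ktq a : 𝔼 → 𝔼 → ℝ} (hKsp : IsKernel s p Λ Ksp)
    (hKtq : IsKernel t q Λ Ktq) (ha : IsCoefficient a)
    (hq : s * p < n → q ≤ n * p / (n - s * p)) {u : 𝔼 → ℝ}
    (hu : IsWeakSolution s t p q Ksp Ktq a Ω u) (hu_tail : MemTail s p q u) {S : Set 𝔼}
    (hS : IsCompact S) (hSΩ : S ⊆ Ω) : ∃ K : ℝ, ∀ᵐ x, x ∈ S → u x ≤ K := by
  rcases S.eq_empty_or_nonempty with rfl | hSne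
  · exact ⟨0, by simp⟩
  obtain ⟨κ, hqκ, hpκ, hκ⟩ := exists_sobolev_exponent hn hs hp hpq hq
  have hn0 : (0 : ℝ) ≤ n := Nat.cast_nonneg n
  have hκ0 : 0 < κ := by linarith
  have hsp : 0 < s * p := by positivity
  have htq : 0 < t * q := mul_pos (by linarith) (by linarith)
  have hsp_lt : s * p < p := by nlinarith
  have hum := hu.memA.measurable
  obtain ⟨M₀, hM₀⟩ := hΩb.subset_ball 0
  set M := max M₀ 1 with hMdef
  have hM0 : 0 < M := lt_max_of_lt_right one_pos
  have hΩM : ∀ x ∈ Ω, ‖x‖ < M := fun x hx => by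
    have := hM₀ hx
    rw [mem_ball_zero_iff] at this
    exact this.trans_le (le_max_left _ _)
  obtain ⟨δ₀, hδ₀, hthick⟩ := hS.exists_thickening_subset_open hΩo hSΩ
  set d : 𝔼 → ℝ := fun x => infDist x S with hd
  have hd1 : ∀ x y, d x - d y ≤ ‖x - y‖ := fun x y => by
    have := infDist_le_infDist_add_dist (s := S) (x := x) (y := y)
    rw [dist_eq_norm] at this
    linarith
  have hdm : Measurable d := measurable_infDist
  have hdS : ∀ x ∈ S, d x = 0 := fun x hx => infDist_zero_of_mem hx
  set δ : ℝ := min (δ₀ / 3) 1 with hδ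
  have hδ0 : 0 < δ := lt_min (by linarith) one_pos
  have hδ1 : δ ≤ 1 := min_le_right _ _
  have hsub : ∀ x, d x < δ + 2 * δ → x ∈ Ω := fun x hx => by
    refine hthick ?_
    rw [mem_thickening_iff_infDist_lt hSne]
    have : δ ≤ δ₀ / 3 := min_le_left _ _
    have hx' : infDist x S < δ + 2 * δ := hx
    linarith
  set V := {x | d x < δ} with hV
  have hVΩ : V ⊆ Ω := fun x hx => hsub x (by
    simp only [hV, mem_ofPred_eq] at hx; linarith)
  have hpfin : ∫⁻ x in Ω, ENNReal.ofReal (|u x| ^ p) ≠ ⊤ := by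
    have h1 := lintegral_rpow_enorm_lt_top_of_eLpNorm_lt_top (p := ENNReal.ofReal p)
      (by simp; linarith) ENNReal.ofReal_ne_top hu.memA.memLp.2
    rw [ENNReal.toReal_ofReal (by linarith)] at h1
    refine ne_of_lt (lt_of_le_of_lt (le_of_eq (lintegral_congr fun x => ?_)) h1)
    rw [← ofReal_norm, Real.norm_eq_abs,
      ENNReal.ofReal_rpow_of_nonneg (abs_nonneg _) (by linarith)]
  -- higher integrability: the Sobolev inequality for `|u|`
  have hκfin : ∫⁻ x in V, ENNReal.ofReal (|u x| ^ κ) ≠ ⊤ := by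
    obtain ⟨C, hC, h1⟩ := local_fractional_sobolev (n := n) (M := M) (N := n + p) hn
      (by linarith : 0 < p) hpκ hκ hsp_lt (by linarith) (by linarith) hM0
    have h2 := h1 d (fun x => |u x|) δ δ hd1 hdm (fun x hx => hΩM x (hsub x hx))
      (fun x => abs_nonneg _) (by fun_prop) hδ0 hδ1
    refine ne_top_of_le_ne_top (ENNReal.rpow_ne_top_of_nonneg
      (div_nonneg hκ0.le (by linarith)) (ENNReal.mul_ne_top hC (ENNReal.add_ne_top.2
        ⟨?_, ENNReal.mul_ne_top ENNReal.ofReal_ne_top ?_⟩))) h2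
    · have hue := (energy_lt_top_iff hsp htq ha.nonneg _ hum).1 hu.memA.energy_lt_top
      refine ne_top_of_le_ne_top hue.1.ne ((lintegral_mono_set
        (prod_subset_crossSet fun x hx => hsub x hx)).trans (lintegral_mono fun z => ?_))
      have := abs_abs_sub_abs_le (u z.1) (u z.2)
      gcongr
    · exact ne_top_of_le_ne_top hpfin (lintegral_mono_set fun x hx => hsub x hx)
  have hVfin : volume V ≠ ⊤ := ne_top_of_le_ne_top
    (measure_ball_lt_top (x := (0 : 𝔼)) (r := M)).ne (measure_mono fun x hx => by
      rw [mem_ball_zero_iff]; exact hΩM x (hVΩ hx))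
  have hqfin := lintegral_rpow_ne_top_of_le hVfin (by linarith) hqκ hκfin
  obtain ⟨C, hC, hstep⟩ := truncation_energy_step hn hs hst ht hp hpq hqκ hpκ hκ hΛ hM0 hKsp hKtq
    ha hu hu_tail
  set N : ℝ := n + q with hN
  have hN0 : 0 < N := by linarith
  set b : ℝ := 2 ^ (N + κ) with hb
  have hb1 : 1 < b := Real.one_lt_rpow (by norm_num) (by linarith)
  obtain ⟨μ, hμ, hiter⟩ := exists_tendsto_zero_of_le_rpow
    (A := C * ENNReal.ofReal ((16 / δ) ^ N * 2 ^ κ)) (γ := κ / p)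
    (ENNReal.mul_ne_top hC ENNReal.ofReal_ne_top) hb1 ((one_lt_div (by linarith)).2 hpκ)
  obtain ⟨K₀, hK₀⟩ := (((tendsto_lintegral_truncation hum hκ0 hκfin).eventually_le_const
    (ENNReal.ofReal_pos.2 hμ)).and (eventually_ge_atTop 1)).exists
  set K : ℝ := (K₀ : ℝ) with hK
  have hK1 : 1 ≤ K := Nat.one_le_cast.2 hK₀.2
  -- radii decreasing from `δ` to `δ / 2`, and levels increasing from `K` to `2 K`
  set r : ℕ → ℝ := fun j => δ / 2 * (1 + (2 ^ j)⁻¹) with hr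
  set k : ℕ → ℝ := fun j => K * (2 - (2 ^ j)⁻¹) with hk
  have hpow : ∀ j : ℕ, (0 : ℝ) < (2 ^ j)⁻¹ ∧ ((2 : ℝ) ^ j)⁻¹ ≤ 1 := fun j =>
    ⟨by positivity, inv_le_one_of_one_le₀ (one_le_pow₀ (by norm_num))⟩
  have hpows : ∀ j : ℕ, ((2 : ℝ) ^ (j + 1))⁻¹ = (2 ^ j)⁻¹ / 2 := fun j => by
    rw [pow_succ]; field_simp
  set Y : ℕ → ℝ≥0∞ := fun j => ∫⁻ x in {x | d x < r j}, ENNReal.ofReal (max (u x - k j) 0 ^ κ)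
    with hY
  have hrδ : ∀ j, r j ≤ δ := fun j => by
    have := (hpow j).2
    simp only [hr]
    nlinarith
  have hYlim : Tendsto Y atTop (𝓝 0) := by
    refine hiter Y ?_ fun j => ?_
    · have hr0 : r 0 = δ := by simp only [hr, pow_zero, inv_one]; ring
      have hk0 : k 0 = K := by simp only [hk, pow_zero, inv_one]; ring
      simp only [hY, hr0, hk0]
      exact hK₀.1
    · set h : ℝ := δ / 16 * (2 ^ j)⁻¹ with hh
      have hpj := hpow j
      have hh0 : 0 < h := mul_pos (by linarith) hpj.1
      have hh1 : h ≤ 1 := by rw [hh]; nlinarith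
      have hrr : r (j + 1) + 4 * h = r j := by
        simp only [hr, hh, hpows]; ring
      have hsubV : {x | d x < r (j + 1) + 4 * h} ⊆ V := fun x hx => by
        rw [hrr] at hx
        exact lt_of_lt_of_le hx (hrδ j)
      have hkj : k j + (2 ^ (j + 1))⁻¹ ≤ k (j + 1) := by
        simp only [hk, hpows]
        nlinarith
      have hk0 : 0 ≤ k (j + 1) := mul_nonneg (by linarith) (by linarith [(hpow (j + 1)).2])
      have := hstep d (r (j + 1)) h (k (j + 1)) (k j) (2 ^ (j + 1))⁻¹ hd1 hdm
        (hsubV.trans hVΩ) (fun x hx => hΩM x (hVΩ (hsubV hx))) hk0 hh0 hh1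
        (hpow (j + 1)).1 (hpow (j + 1)).2 hkj
        (ne_top_of_le_ne_top hpfin (lintegral_mono_set (hsubV.trans hVΩ)))
        (ne_top_of_le_ne_top hqfin (lintegral_mono_set hsubV))
      rw [hrr] at this
      refine this.trans (le_of_eq ?_)
      congr 2
      rw [mul_assoc C, ← ENNReal.ofReal_mul (by positivity)]
      congr 2
      have e1 : h⁻¹ = 16 / δ * 2 ^ j := by rw [hh]; field_simp
      rw [e1, inv_inv, Real.mul_rpow (by positivity) (by positivity), pow_succ,
        Real.mul_rpow (by positivity) (by norm_num), hb, ← Real.rpow_natCast,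
        ← Real.rpow_natCast, ← Real.rpow_mul (by norm_num), ← Real.rpow_mul (by norm_num),
        ← Real.rpow_mul (by norm_num)]
      rw [show (N + κ) * (j : ℝ) = j * N + j * κ by ring,
        Real.rpow_add two_pos ((j : ℝ) * N)]
      ring
  have hzero : ∫⁻ x in S, ENNReal.ofReal (max (u x - 2 * K) 0 ^ κ) = 0 := by
    refine le_antisymm (ge_of_tendsto' hYlim fun j => ?_) zero_le
    have hpj := hpow j
    refine (lintegral_mono_set (fun x hx => ?_)).trans (lintegral_mono fun x => ?_)
    · show d x < r j
      rw [hdS x hx]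
      exact mul_pos (by linarith) (by linarith)
    · have hkj : k j ≤ 2 * K := by simp only [hk]; nlinarith
      refine ENNReal.ofReal_le_ofReal (Real.rpow_le_rpow (le_max_right _ _) ?_ hκ0.le)
      exact max_le_max (by linarith) le_rfl
  refine ⟨2 * K, ?_⟩
  rw [lintegral_eq_zero_iff' (AEMeasurable.restrict (by fun_prop)), EventuallyEq,
    ae_restrict_iff' hS.measurableSet] at hzero
  filter_upwards [hzero] with x hx hxS
  by_contra! hcon
  have h1 := hx hxS
  rw [Pi.zero_apply, ENNReal.ofReal_eq_zero, max_eq_left (by linarith)] at h1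
  exact absurd h1 (not_le.2 (Real.rpow_pos_of_pos (by linarith) _))

lemma MemA.neg {s t p q : ℝ} {a : 𝔼 → 𝔼 → ℝ} {Ω : Set 𝔼} {v : 𝔼 → ℝ}
    (hv : MemA s t p q a Ω v) : MemA s t p q a Ω (fun x => -v x) where
  measurable := hv.measurable.neg
  memLp := hv.memLp.neg
  energy_lt_top := by
    have : ∀ z : 𝔼 × 𝔼, |(-v z.1) - -v z.2| = |v z.1 - v z.2| := fun z => by
      rw [← neg_sub', abs_neg]
    simp only [this]
    exact hv.energy_lt_top

lemma IsWeakSolution.neg {s t p q : ℝ} {Ksp Ktq a : 𝔼 → 𝔼 → ℝ} {Ω : Set 𝔼} {u : 𝔼 → ℝ}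
    (hu : IsWeakSolution s t p q Ksp Ktq a Ω u) :
    IsWeakSolution s t p q Ksp Ktq a Ω (fun x => -u x) where
  memA := hu.memA.neg
  weak_eq φ hφ hφ0 := by
    have : ∀ x y, weakIntegrand p q Ksp Ktq a (fun x => -u x) φ x y =
        -weakIntegrand p q Ksp Ktq a u φ x y := fun x y => by
      simp only [weakIntegrand]
      rw [← neg_sub', abs_neg]
      ring
    simp only [this]
    rw [integral_neg, hu.weak_eq φ hφ hφ0, neg_zero]

end DoublePhase

end

theorem theorem1p1 (n : ℕ) (hn : 2 ≤ n) (s t p q Λ : ℝ)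
    (hs : 0 < s) (hst : s ≤ t) (ht : t < 1) (hp : 1 < p) (hpq : p ≤ q) (hΛ : 1 < Λ)
    (Ω : Set (EuclideanSpace ℝ (Fin n)))
    (hΩ_open : IsOpen Ω) (hΩ_conn : IsConnected Ω) (hΩ_bdd : Bornology.IsBounded Ω)
    (Ksp Ktq a : EuclideanSpace ℝ (Fin n) → EuclideanSpace ℝ (Fin n) → ℝ)
    (hKsp : DoublePhase.IsKernel s p Λ Ksp) (hKtq : DoublePhase.IsKernel t q Λ Ktq)
    (ha : DoublePhase.IsCoefficient a)
    (hq : s * p < n → q ≤ n * p / (n - s * p))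
    (u : EuclideanSpace ℝ (Fin n) → ℝ)
    (hu : DoublePhase.IsWeakSolution s t p q Ksp Ktq a Ω u)
    (hu_tail : DoublePhase.MemTail s p q u) :
    DoublePhase.LocallyBoundedIn Ω u := by
  intro S hS hSΩ
  have hu_tail' : DoublePhase.MemTail s p q (fun x => -u x) :=
    ⟨hu_tail.measurable.neg, by simpa only [abs_neg] using hu_tail.lt_top⟩
  obtain ⟨K₁, h₁⟩ := DoublePhase.exists_ae_le_of_isWeakSolution (by omega) hs hst ht hp hpq hΛ
    hΩ_open hΩ_bdd hKsp hKtq ha hq hu hu_tail hS hSΩ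
  obtain ⟨K₂, h₂⟩ := DoublePhase.exists_ae_le_of_isWeakSolution (by omega) hs hst ht hp hpq hΛ
    hΩ_open hΩ_bdd hKsp hKtq ha hq hu.neg hu_tail' hS hSΩ
  refine ⟨max K₁ K₂, ?_⟩
  filter_upwards [h₁, h₂] with x hx₁ hx₂ hxS
  exact abs_le.2 ⟨by linarith [hx₂ hxS, le_max_right K₁ K₂], (hx₁ hxS).trans (le_max_left _ _)⟩
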